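/- A \emph{generalized $2$-tree} is a graph obtained from $K_2$ by applying finitely many times (possibly zero) the following operation: introduce a new vertex and join it either to exactly one vertex of the current graph or to exactly two adjacent vertices of the current graph. The \emph{square} $G^2$ of a graph $G$ has the same vertex set as $G$, with two vertices adjacent if and only if their distance in $G$ is $1$ or $2$. A \emph{clique minor of order $t$} of a graph $H$ (a $K_t$-minor) is a family of $t$ pairwise vertex-disjoint connected (non-empty) subgraphs of $H$, called its \emph{branch sets}, such that any two of them are joined by at least one edge of $H$. \emph{Hadwiger's conjecture is true for $H$} if, for every integer $t \ge 1$, $H$ is $t$-colorable whenever it has no $K_{t+1}$-minor. Hadwiger's conjecture is true for squares of generalized $2$-trees. Moreover, for any generalized $2$-tree $G$, the graph $G^2$ has a clique minor of order $\chi(G^2)$ for which all branch sets are paths (possibly of length $0$). -/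

import Mathlib

namespace HadwigerSquares

variable {V : Type*}

/-- `BuiltOn G S`: the subgraph of `G` induced by `S` is obtained by starting with a `K₂` and
repeatedly introducing a fresh vertex `w` and joining it, within the current graph, to exactly
one vertex or to exactly the two ends of an edge. -/
inductive BuiltOn (G : SimpleGraph V) : Set V → Prop
  | base (u v : V) (huv : G.Adj u v) : BuiltOn G {u, v}
  | joinVertex (S : Set V) (u w : V) (hS : BuiltOn G S) (hw : w ∉ S) (hu : u ∈ S)
      (hadj : ∀ x ∈ S, G.Adj w x ↔ x = u) : BuiltOn G (insert w S)
  | joinEdge (S : Set V) (u v w : V) (hS : BuiltOn G S) (hw : w ∉ S) (hu : u ∈ S) (hv : v ∈ S)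
      (huv : G.Adj u v) (hadj : ∀ x ∈ S, G.Adj w x ↔ x = u ∨ x = v) : BuiltOn G (insert w S)

/-- Generalized 2-trees: the construction above exhausts the vertex set. -/
def IsGeneralizedTwoTree (G : SimpleGraph V) : Prop := BuiltOn G Set.univ

/-- The square of `G`: two vertices are adjacent iff their distance in `G` is 1 or 2
(`SimpleGraph.dist` is 0 on pairs of vertices in different components). -/
def square (G : SimpleGraph V) : SimpleGraph V where
  Adj u v := G.dist u v = 1 ∨ G.dist u v = 2
  symm := ⟨fun u v h => by rwa [G.dist_comm (u := v) (v := u)]⟩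
  loopless := ⟨fun u h => by simp at h⟩

/-- The subgraphs `B i` are the branch sets of a clique minor of order `t` of `H`: they are
connected (in particular non-empty), pairwise vertex-disjoint, and any two of them are joined
by an edge of `H`. -/
structure IsCliqueMinor (H : SimpleGraph V) {t : ℕ} (B : Fin t → H.Subgraph) : Prop where
  connected : ∀ i, (B i).Connected
  disjoint : ∀ i j, i ≠ j → Disjoint (B i).verts (B j).verts
  joined : ∀ i j, i ≠ j → ∃ x ∈ (B i).verts, ∃ y ∈ (B j).verts, H.Adj x y

/-- `H` has a `K_t`-minor. -/
def HasCliqueMinor (H : SimpleGraph V) (t : ℕ) : Prop :=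
  ∃ B : Fin t → H.Subgraph, IsCliqueMinor H B

/-- Hadwiger's conjecture is true for the graph `H`. -/
def HadwigerHolds (H : SimpleGraph V) : Prop :=
  ∀ t : ℕ, 1 ≤ t → ¬ HasCliqueMinor H (t + 1) → H.Colorable t

/-- The subgraph `P` of `H` is a path (possibly of length 0). -/
def IsPathSubgraph (H : SimpleGraph V) (P : H.Subgraph) : Prop :=
  ∃ (a b : V) (p : H.Walk a b), p.IsPath ∧ P = p.toSubgraph

end HadwigerSquares

/-! It is enough to show, for every `K`, that the square of `G` is `K`-colourable or has a path
minor of order `K + 1`. Hadwiger's conjecture follows at once, and taking `K` one below the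
chromatic number gives the second claim.

Two kinds of minors suffice. A closed neighbourhood is a clique of the square. A triangle of `G`,
together with disjoint links (sets connected in the square that meet the neighbourhoods of two
corners), is a clique minor once links are cut down to paths: two sides of a triangle share a
corner, so any two links contain distinct neighbours of one vertex. If neither kind reaches order `K
+ 1`, then `LinkBounded G K` holds.

Under `LinkBounded` the construction of `G` is undone one vertex at a time. A vertex `p` on an edge
`xy`, with all that hangs at `xp` and `yp`, is merged into what hangs at `xy`. Of this set only
numbers are kept: how many colours it needs around `x` and around `y`, how many links it carries,
and lower bounds `lo` and `W` on the intersection and the union of the two colour sets. The bounds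
`lo` and `W` are exactly what makes the merged colour sets separable again (`exists_split`,
`exists_disjoint_pair`). The inequalities `SideBounds` say that these demands can be met, and they
survive merging (`SideBounds.triangle`, `SideBounds.add`) because of the degree and triangle bounds.
The initial edge is coloured directly, and the vertices are then put back (`IsPalette.joinVertex`,
`IsPalette.joinEdge`). -/

namespace HadwigerSquares

/-! ### Arithmetic of the side bounds -/

/-- Inequalities between the numbers attached to one side of an edge `uv` when `K` colours are
left after colouring `u` and `v`: the side contains `a` neighbours of `u` and `b` neighbours of `v`,
at least `lo` colours are used on both and at least `W` on one of these two sets, and there are `f`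
disjoint links between `u` and `v` on this side and `φ` on the other one. -/
structure SideBounds (K a b f lo W φ : ℕ) : Prop where
  f_le : f ≤ a ∧ f ≤ b
  lo_le : lo ≤ a ∧ lo ≤ b
  lo_add : lo + W ≤ a + b
  W_φ : W + φ ≤ K
  lo_φ : lo ≤ f ∨ (lo + φ ≤ a ∧ lo + φ ≤ b)
  W_f : W ≤ a + f ∨ W ≤ b + f
  lo_f : lo ≤ f ∨ lo + K ≤ a + b + f

theorem min_dichotomy (a b : ℕ) : min a b = a ∧ a ≤ b ∨ min a b = b ∧ b ≤ a := by
  omega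

/-- This and the next two estimates treat the candidates in the maxima defining `lo` and `W` for the
block of a vertex `p` on an edge `xy`. Indices 2 and 3 refer to the edges `xp` and `yp`. Seen from
`xp`, the outside links are `y` itself and links from `x` to `y` continued from `y` to `p`, whence
`1 + min φ f3`. -/
theorem SideBounds.lo_add_lo_le {K f2 f3 φ a2 d2 b3 d3 lo2 lo3 W2 W3 : ℕ}
    (T : φ + f2 + f3 ≤ K) (hd : d2 + d3 ≤ K) (hx : φ + a2 ≤ K) (hy : φ + b3 ≤ K)
    (h2 : SideBounds (K + 1) a2 d2 f2 lo2 W2 (1 + min φ f3))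
    (h3 : SideBounds (K + 1) b3 d3 f3 lo3 W3 (1 + min φ f2)) :
    lo2 + lo3 + φ ≤ K ∧ (lo2 + lo3 ≤ a2 + 1 + min f2 f3 ∨ lo2 + lo3 ≤ b3 + 1 + min f2 f3) := by
  obtain ⟨A1, A2, -, -, A5, -, A7⟩ := h2
  obtain ⟨B1, B2, -, -, B5, -, B7⟩ := h3
  have m1 := min_dichotomy φ f3
  have m2 := min_dichotomy φ f2
  have m3 := min_dichotomy f2 f3
  generalize min φ f3 = x at *
  generalize min φ f2 = y at *
  generalize min f2 f3 = z at *
  rcases m1 with m1 | m1 <;> rcases m2 with m2 | m2 <;> rcases m3 with m3 | m3 <;>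
    rcases A5 with A5 | A5 <;> rcases B5 with B5 | B5 <;> constructor <;> omega

theorem SideBounds.W_add_W_le {K f2 f3 φ a2 d2 b3 d3 lo2 lo3 W2 W3 : ℕ}
    (T : φ + f2 + f3 ≤ K) (hd : d2 + d3 ≤ K) (hx : φ + a2 ≤ K) (hy : φ + b3 ≤ K)
    (h2 : SideBounds (K + 1) a2 d2 f2 lo2 W2 (1 + min φ f3))
    (h3 : SideBounds (K + 1) b3 d3 f3 lo3 W3 (1 + min φ f2)) :
    W2 + W3 + φ ≤ K + K ∧
      (W2 + W3 ≤ K + a2 + 1 + min f2 f3 ∨ W2 + W3 ≤ K + b3 + 1 + min f2 f3) := by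
  obtain ⟨A1, -, -, A4, -, A6, -⟩ := h2
  obtain ⟨B1, -, -, B4, -, B6, -⟩ := h3
  have m1 := min_dichotomy φ f3
  have m2 := min_dichotomy φ f2
  have m3 := min_dichotomy f2 f3
  generalize min φ f3 = x at *
  generalize min φ f2 = y at *
  generalize min f2 f3 = z at *
  rcases m1 with m1 | m1 <;> rcases m2 with m2 | m2 <;> rcases m3 with m3 | m3 <;>
    rcases A6 with A6 | A6 <;> rcases B6 with B6 | B6 <;> constructor <;> omega

theorem SideBounds.lo_add_W_le {K f2 f3 φ a2 d2 b3 d3 lo2 lo3 W2 W3 : ℕ}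
    (T : φ + f2 + f3 ≤ K) (hd : d2 + d3 ≤ K) (hx : φ + a2 ≤ K) (hy : φ + b3 ≤ K)
    (h2 : SideBounds (K + 1) a2 d2 f2 lo2 W2 (1 + min φ f3))
    (h3 : SideBounds (K + 1) b3 d3 f3 lo3 W3 (1 + min φ f2)) :
    lo2 + W3 - K ≤ a2 ∧ lo2 + W3 - K ≤ b3 ∧
    (lo2 + W3 - K ≤ min f2 f3 ∨ lo2 + W3 - K + φ ≤ a2 ∧ lo2 + W3 - K + φ ≤ b3) ∧
    (lo2 + W3 - K ≤ min f2 f3 ∨ lo2 + W3 - K + K ≤ a2 + b3 + 1 + min f2 f3) := by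
  obtain ⟨A1, A2, -, A4, A5, -, A7⟩ := h2
  obtain ⟨B1, B2, B3, B4, -, B6, -⟩ := h3
  have m1 := min_dichotomy φ f3
  have m2 := min_dichotomy φ f2
  have m3 := min_dichotomy f2 f3
  generalize min φ f3 = x at *
  generalize min φ f2 = y at *
  generalize min f2 f3 = z at *
  obtain hp | ⟨p, hp⟩ : lo2 + W3 ≤ K ∨ ∃ p, lo2 + W3 = K + p := by
    rcases le_total (lo2 + W3) K with h | h
    · exact .inl h
    · exact .inr (Nat.exists_eq_add_of_le h)
  · rw [Nat.sub_eq_zero_of_le hp]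
    refine ⟨by omega, by omega, .inl (by omega), .inl (by omega)⟩
  · rw [hp, Nat.add_sub_cancel_left]
    rcases m1 with m1 | m1 <;> rcases m2 with m2 | m2 <;> rcases m3 with m3 | m3 <;>
      rcases A5 with A5 | A5 <;> rcases B6 with B6 | B6 <;> refine ⟨?_, ?_, ?_, ?_⟩ <;> omega

/-- `K` counts the colours left after those of `x`, `y` and `p`, so `K + 1` are left for an edge.
Every summand 1 in the conclusion is `p`: a neighbour of both `x` and `y`, a link between them, and
a colour common to both sets. -/
theorem SideBounds.triangle {K f2 f3 φ a2 d2 b3 d3 lo2 lo3 W2 W3 : ℕ}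
    (T : φ + f2 + f3 ≤ K) (hd : d2 + d3 ≤ K) (hx : φ + a2 ≤ K) (hy : φ + b3 ≤ K)
    (h2 : SideBounds (K + 1) a2 d2 f2 lo2 W2 (1 + min φ f3))
    (h3 : SideBounds (K + 1) b3 d3 f3 lo3 W3 (1 + min φ f2)) :
    SideBounds (K + 1) (1 + a2) (1 + b3) (1 + min f2 f3) (1 + max (lo2 + W3 - K) (W2 + lo3 - K))
      (1 + max (lo2 + lo3) (W2 + W3 - K)) φ := by
  obtain ⟨k1, k2⟩ := SideBounds.lo_add_lo_le T hd hx hy h2 h3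
  obtain ⟨k3, k4⟩ := SideBounds.W_add_W_le T hd hx hy h2 h3
  obtain ⟨p1, p2, p3, p4⟩ := SideBounds.lo_add_W_le T hd hx hy h2 h3
  obtain ⟨q1, q2, q3, q4⟩ := SideBounds.lo_add_W_le (by omega) (by omega) hy hx h3 h2
  rw [Nat.add_comm W2 lo3, min_comm f3 f2] at *
  obtain ⟨A1, A2, A3, A4, -, -, -⟩ := h2
  obtain ⟨B1, B2, B3, B4, -, -, -⟩ := h3
  -- One inequality for each choice of terms attaining the two maxima; together they give the field
  -- `lo_add`.
  have v1 : lo2 + lo3 + (lo2 + W3 - K) ≤ a2 + b3 := by omega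
  have v2 : lo2 + lo3 + (lo3 + W2 - K) ≤ a2 + b3 := by omega
  have v3 : (W2 + W3 - K) + (lo2 + W3 - K) ≤ a2 + b3 := by omega
  have v4 : (W2 + W3 - K) + (lo3 + W2 - K) ≤ a2 + b3 := by omega
  have r5 : W2 + W3 - K + φ ≤ K := by omega
  have r6 : W2 + W3 - K ≤ a2 + 1 + min f2 f3 ∨ W2 + W3 - K ≤ b3 + 1 + min f2 f3 := by omega
  have zz : min f2 f3 ≤ a2 ∧ min f2 f3 ≤ b3 := by omega
  clear k3 k4 A1 A2 A3 A4 B1 B2 B3 B4 T hd hx hy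
  generalize min f2 f3 = z at *
  generalize lo2 + W3 - K = p at *
  generalize lo3 + W2 - K = q at *
  generalize W2 + W3 - K = r at *
  generalize lo2 + lo3 = t at *
  rcases max_cases p q with ⟨h, -⟩ | ⟨h, -⟩ <;> rcases max_cases t r with ⟨h', -⟩ | ⟨h', -⟩ <;>
    rw [h, h'] <;> constructor <;> omega

/-- Links through one side are outside links for the other. The mixed sums in `W` arise because the
union of the two colour sets of one side is disjoint from the intersection of those of the other. -/
theorem SideBounds.add {K a1 b1 f1 lo1 W1 a2 b2 f2 lo2 W2 φ : ℕ} (hx : φ + a1 + a2 ≤ K)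
    (hy : φ + b1 + b2 ≤ K) (h1 : SideBounds K a1 b1 f1 lo1 W1 (φ + f2))
    (h2 : SideBounds K a2 b2 f2 lo2 W2 (φ + f1)) :
    SideBounds K (a1 + a2) (b1 + b2) (f1 + f2) (lo1 + lo2) (max (W1 + lo2) (lo1 + W2)) φ := by
  obtain ⟨A1,A2,A3,A4,A5,A6,A7⟩ := h1
  obtain ⟨B1,B2,B3,B4,B5,B6,B7⟩ := h2
  rcases max_cases (W1 + lo2) (lo1 + W2) with ⟨h, -⟩ | ⟨h, -⟩ <;> rw [h] <;> constructor <;> omega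

/-! ### Finite sets with prescribed intersections and unions -/

section FiniteSets

open Finset

/-- A lattice point is sought in a box, with its sum and its difference in given intervals. Only
parity can obstruct, when both intervals are single points; `hpar` excludes this. -/
theorem exists_sum_diff {l r l' r' M A B C E : ℕ} (m : ℕ) (h1 : l ≤ r) (h2 : l' ≤ r')
    (hM : l + l' ≤ M) (hB : l + A ≤ r' + B) (hE : l' + C ≤ r + E) (hBE : A + C ≤ B + E)
    (hBM : 2 * l + A ≤ M + B) (hEM : 2 * l' + C ≤ M + E)
    (hm : m ≤ r + r') (hmB : m + A ≤ 2 * r' + B) (hmE : m + C ≤ 2 * r + E) (hmM : m ≤ M)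
    (hpar : m + 1 ≤ M ∨ A + C + 1 ≤ B + E) :
    ∃ α β, l ≤ α ∧ α ≤ r ∧ l' ≤ β ∧ β ≤ r' ∧ m ≤ α + β ∧ α + β ≤ M ∧
      α + A ≤ β + B ∧ β + C ≤ α + E := by
  induction m with
  -- The least point obeying the lower bounds and the two difference constraints.
  | zero => exact ⟨max l (l' + C - E), max l' (l + A - B), by omega⟩
  | succ m ih =>
    obtain ⟨α, β, h⟩ := ih (by omega) (by omega) (by omega) (by omega) (by omega)
    by_cases c : m + 1 ≤ α + β
    · exact ⟨α, β, by omega⟩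
    by_cases c1 : α < r ∧ α + A < β + B
    · exact ⟨α + 1, β, by omega⟩
    by_cases c2 : β < r' ∧ β + C < α + E
    · exact ⟨α, β + 1, by omega⟩
    -- Here both difference constraints are tight, so `hpar` leaves room for the sum to grow by two.
    exact ⟨α + 1, β + 1, by omega⟩

theorem exists_two_subsets {α : Type*} [DecidableEq α] (s : Finset α) {m n : ℕ} (h : m + n ≤ #s) :
    ∃ t u, t ⊆ s ∧ u ⊆ s ∧ Disjoint t u ∧ #t = m ∧ #u = n := by
  obtain ⟨t, ht, hm⟩ := exists_subset_card_eq (show m ≤ #s by omega)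
  obtain ⟨u, hu, hn⟩ := exists_subset_card_eq (show n ≤ #(s \ t) by
    rw [card_sdiff_of_subset ht]; omega)
  exact ⟨t, u, ht, hu.trans sdiff_subset, disjoint_of_subset_right hu disjoint_sdiff, hm, hn⟩

/-- A transportation problem: the demands `α`, `β`, `d - α`, `e - β` draw on the supplies `s, p`, on
`s, q`, on `q, n` and on `p, n`. These incidences form an 8-cycle, and the hypotheses are the
nonnegativity of demands and Hall's conditions for arcs of the cycle. The supply `s` is shared out
first, the rest greedily. -/
theorem exists_region_sizes {s p q n d e α β : ℕ} (h1 : α ≤ s + p) (h2 : β ≤ s + q) (h3 : α ≤ d) (h4 : β ≤ e)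
    (h5 : d ≤ α + q + n) (h6 : e ≤ β + p + n) (h7 : α + β ≤ s + p + q) (h8 : α + e ≤ β + s + p + n)
    (h9 : d + β ≤ α + s + q + n) (h10 : d + e ≤ α + β + p + q + n) (h11 : d + e ≤ s + p + q + n) :
    ∃ s₂ s₃ p₂ p₃ q₂ q₃ n₂ n₃, s₂ + s₃ ≤ s ∧ p₂ + p₃ ≤ p ∧ q₂ + q₃ ≤ q ∧ n₂ + n₃ ≤ n ∧
      s₂ + p₂ = α ∧ q₂ + n₂ + α = d ∧ s₃ + q₃ = β ∧ p₃ + n₃ + β = e := by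
  obtain ⟨x, hx0, hx1, hx2, hx3, hx⟩ : ∃ x, x ≤ s ∧ x ≤ α ∧ x + β ≤ s + q ∧ α ≤ x + p ∧
      (e + α ≤ β + p + x ∨ x = s ∨ x = α ∨ x + β = s + q) ∧
      (x = 0 ∨ β + p + x ≤ e + α) := by
    by_cases c : e + α - β - p ≤ s ∧ e + α - β - p ≤ α ∧ e + α - β - p ≤ s + q - β
    · exact ⟨e + α - β - p, by omega⟩
    · refine ⟨min s (min α (s + q - β)), ?_⟩
      rcases min_choice s (min α (s + q - β)) with h | h
      · omega
      · rcases min_choice α (s + q - β) with h' | h' <;> omega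
  obtain ⟨y, hy0, hy1, hy⟩ : ∃ y, y ≤ β ∧ x + y ≤ s ∧ (y = β ∨ x + y = s) := by
    by_cases c : x + β ≤ s
    · exact ⟨β, by omega⟩
    · exact ⟨s - x, by omega⟩
  obtain ⟨z, hz0, hz1, hz⟩ : ∃ z, z + α ≤ d ∧ z + β ≤ q + y ∧ (z + α = d ∨ z + β = q + y) := by
    by_cases c : d + β ≤ q + y + α
    · exact ⟨d - α, by omega⟩
    · exact ⟨q + y - β, by omega⟩
  obtain ⟨w, hw0, hw1, hw⟩ : ∃ w, w + β ≤ e ∧ w + α ≤ p + x ∧ (w + β = e ∨ w + α = p + x) := by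
    by_cases c : e + α ≤ p + x + β
    · exact ⟨e - β, by omega⟩
    · exact ⟨p + x - α, by omega⟩
  refine ⟨x, y, α - x, w, z, β - y, d - α - z, e - β - w, ?_, ?_, ?_, ?_, ?_, ?_, ?_, ?_⟩ <;> omega

/-- Here `α` and `β` are to be the sizes of `P ∩ D` and `Q ∩ E`. A lower bound on a union is an
upper bound on the intersection, so all requirements are intervals for `α`, `β`, their sum and their
difference. -/
theorem exists_intersection_sizes {s p q n d e lo₂ lo₃ W₂ W₃ : ℕ} (hX0 : 0 < s + p + q + n)
    (hde : d + e ≤ s + p + q + n)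
    (h2 : lo₂ ≤ s + p) (h2' : lo₂ ≤ d) (h2W : lo₂ + W₂ ≤ s + p + d) (hW2 : W₂ ≤ s + p + q + n)
    (h3 : lo₃ ≤ s + q) (h3' : lo₃ ≤ e) (h3W : lo₃ + W₃ ≤ s + q + e) (hW3 : W₃ ≤ s + p + q + n)
    (h23 : lo₂ + lo₃ ≤ s + p + q) (hWW : W₂ + W₃ ≤ s + p + q + n + (s + p + q))
    (h2W3 : lo₂ + W₃ ≤ s + p + q + n + s) (h3W2 : W₂ + lo₃ ≤ s + p + q + n + s) :
    ∃ α β, lo₂ ≤ α ∧ d ≤ α + q + n ∧ α ≤ s + p ∧ α ≤ d ∧ α + W₂ ≤ s + p + d ∧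
      lo₃ ≤ β ∧ e ≤ β + p + n ∧ β ≤ s + q ∧ β ≤ e ∧ β + W₃ ≤ s + q + e ∧
      d + e ≤ α + β + p + q + n ∧ α + β ≤ s + p + q ∧ α + e ≤ β + s + p + n ∧
      d + β ≤ α + s + q + n := by
  obtain ⟨l, hl, hl', hl''⟩ : ∃ l, lo₂ ≤ l ∧ d ≤ l + q + n ∧ (l = lo₂ ∨ l + q + n = d) :=
    ⟨max lo₂ (d - (q + n)), by omega, by omega, by omega⟩
  obtain ⟨l', hk, hk', hk''⟩ : ∃ l, lo₃ ≤ l ∧ e ≤ l + p + n ∧ (l = lo₃ ∨ l + p + n = e) :=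
    ⟨max lo₃ (e - (p + n)), by omega, by omega, by omega⟩
  obtain ⟨r, hr1, hr2, hr3, hr⟩ : ∃ r, r ≤ s + p ∧ r ≤ d ∧ r + W₂ ≤ s + p + d ∧
      (r = s + p ∨ r = d ∨ r + W₂ = s + p + d) := by
    by_cases c : s + p + d ≤ W₂ + min (s + p) d
    · exact ⟨s + p + d - W₂, by omega, by omega, by omega, by omega⟩
    · exact ⟨min (s + p) d, by omega, by omega, by omega, by omega⟩
  obtain ⟨r', ht1, ht2, ht3, ht⟩ : ∃ r, r ≤ s + q ∧ r ≤ e ∧ r + W₃ ≤ s + q + e ∧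
      (r = s + q ∨ r = e ∨ r + W₃ = s + q + e) := by
    by_cases c : s + q + e ≤ W₃ + min (s + q) e
    · exact ⟨s + q + e - W₃, by omega, by omega, by omega, by omega⟩
    · exact ⟨min (s + q) e, by omega, by omega, by omega, by omega⟩
  obtain ⟨m, hm1, hm⟩ : ∃ m, d + e ≤ m + p + q + n ∧ (m = 0 ∨ d + e = m + p + q + n) :=
    ⟨d + e - (p + q + n), by omega, by omega⟩
  obtain ⟨α, β, h⟩ := exists_sum_diff (l := l) (r := r) (l' := l') (r' := r')
    (M := s + p + q) (A := e) (B := s + p + n) (C := d) (E := s + q + n) m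
    (by omega) (by omega) (by omega) (by omega) (by omega) (by omega) (by omega) (by omega)
    (by omega) (by omega) (by omega) (by omega) (by omega)
  exact ⟨α, β, by omega⟩

/-- The last four hypotheses are also necessary. For disjoint `D` and `E`, the sets `P ∩ D` and `Q ∩
E` are disjoint inside `P ∪ Q`; `P ∪ D` and `Q ∪ E` meet only inside `P ∪ Q`; and `P ∩ D` meets `Q ∪
E` only inside `P ∩ Q`. -/
theorem exists_disjoint_pair {ι : Type*} [DecidableEq ι] {X P Q : Finset ι} (hP : P ⊆ X)
    (hQ : Q ⊆ X) {d e lo₂ lo₃ W₂ W₃ : ℕ} (hde : d + e ≤ #X)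
    (h2 : lo₂ ≤ #P) (h2' : lo₂ ≤ d) (h2W : lo₂ + W₂ ≤ #P + d) (hW2 : W₂ ≤ #X)
    (h3 : lo₃ ≤ #Q) (h3' : lo₃ ≤ e) (h3W : lo₃ + W₃ ≤ #Q + e) (hW3 : W₃ ≤ #X)
    (h23 : lo₂ + lo₃ ≤ #(P ∪ Q)) (hWW : W₂ + W₃ ≤ #X + #(P ∪ Q))
    (h2W3 : lo₂ + W₃ ≤ #X + #(P ∩ Q)) (h3W2 : W₂ + lo₃ ≤ #X + #(P ∩ Q)) :
    ∃ D E, D ⊆ X ∧ E ⊆ X ∧ Disjoint D E ∧ #D = d ∧ #E = e ∧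
      lo₂ ≤ #(P ∩ D) ∧ W₂ ≤ #(P ∪ D) ∧ lo₃ ≤ #(Q ∩ E) ∧ W₃ ≤ #(Q ∪ E) := by
  -- The empty `X` is the one case in which the parity proviso of `exists_sum_diff` fails.
  rcases Nat.eq_zero_or_pos #X with hX0 | hX0
  · exact ⟨∅, ∅, by simp, by simp, by simp, by simp; omega, by simp; omega, by simp; omega,
      by simp; omega, by simp; omega, by simp; omega⟩
  obtain ⟨s, hs⟩ : ∃ s, s = #(P ∩ Q) := ⟨_, rfl⟩
  obtain ⟨p, hp⟩ : ∃ s, s = #(P \ Q) := ⟨_, rfl⟩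
  obtain ⟨q, hq⟩ : ∃ s, s = #(Q \ P) := ⟨_, rfl⟩
  obtain ⟨n, hn⟩ : ∃ s, s = #(X \ (P ∪ Q)) := ⟨_, rfl⟩
  have cP : #P = s + p := by have := card_inter_add_card_sdiff P Q; omega
  have cQ : #Q = s + q := by have := card_inter_add_card_sdiff Q P; rw [inter_comm] at this; omega
  have cU : #(P ∪ Q) = s + p + q := by have := card_union_add_card_inter P Q; omega
  have cX : #X = s + p + q + n := by
    have := card_sdiff_add_card_eq_card (union_subset hP hQ); omega
  rw [cX] at hde hW2 hW3 hWW h2W3 h3W2 hX0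
  rw [cU] at h23 hWW
  rw [← hs] at h2W3 h3W2
  rw [cP] at h2 h2W
  rw [cQ] at h3 h3W
  obtain ⟨α, β, h⟩ :=
    exists_intersection_sizes hX0 hde h2 h2' h2W hW2 h3 h3' h3W hW3 h23 hWW h2W3 h3W2
  obtain ⟨s₂, s₃, p₂, p₃, q₂, q₃, n₂, n₃, hs', hp', hq', hn', h'⟩ :=
    exists_region_sizes (s := s) (p := p) (q := q) (n := n) (d := d) (e := e) (α := α) (β := β)
      (by omega) (by omega) (by omega) (by omega) (by omega) (by omega) (by omega) (by omega)
      (by omega) (by omega) (by omega)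
  obtain ⟨S₂, S₃, hS₂, hS₃, dS, cS₂, cS₃⟩ := exists_two_subsets (P ∩ Q) (hs ▸ hs')
  obtain ⟨P₂, P₃, hP₂, hP₃, dP, cP₂, cP₃⟩ := exists_two_subsets (P \ Q) (hp ▸ hp')
  obtain ⟨Q₂, Q₃, hQ₂, hQ₃, dQ, cQ₂, cQ₃⟩ := exists_two_subsets (Q \ P) (hq ▸ hq')
  obtain ⟨N₂, N₃, hN₂, hN₃, dN, cN₂, cN₃⟩ := exists_two_subsets (X \ (P ∪ Q)) (hn ▸ hn')
  have key : ∀ S' P' Q' N' : Finset ι, S' ⊆ P ∩ Q → P' ⊆ P \ Q → Q' ⊆ Q \ P →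
      N' ⊆ X \ (P ∪ Q) → (S' ∪ P' ∪ Q' ∪ N' ⊆ X) ∧ #(S' ∪ P' ∪ Q' ∪ N') = #S' + #P' + #Q' + #N' ∧
      P ∩ (S' ∪ P' ∪ Q' ∪ N') = S' ∪ P' ∧ Q ∩ (S' ∪ P' ∪ Q' ∪ N') = S' ∪ Q' ∧
      #(S' ∪ P') = #S' + #P' ∧ #(S' ∪ Q') = #S' + #Q' := by
    intro S' P' Q' N' hS hP' hQ' hN
    simp only [subset_iff, mem_inter, mem_sdiff, mem_union, not_or] at *
    refine ⟨by grind, ?_, by ext; grind, by ext; grind, ?_, ?_⟩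
    · rw [card_union_of_disjoint, card_union_of_disjoint, card_union_of_disjoint] <;>
        rw [disjoint_left] <;> grind
    · rw [card_union_of_disjoint]; rw [disjoint_left]; grind
    · rw [card_union_of_disjoint]; rw [disjoint_left]; grind
  obtain ⟨D1, D2, D3, D4, D5, D6⟩ := key S₂ P₂ Q₂ N₂ hS₂ hP₂ hQ₂ hN₂
  obtain ⟨E1, E2, E3, E4, E5, E6⟩ := key S₃ P₃ Q₃ N₃ hS₃ hP₃ hQ₃ hN₃
  have u1 := card_union_add_card_inter P (S₂ ∪ P₂ ∪ Q₂ ∪ N₂)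
  have u2 := card_union_add_card_inter Q (S₃ ∪ P₃ ∪ Q₃ ∪ N₃)
  refine ⟨S₂ ∪ P₂ ∪ Q₂ ∪ N₂, S₃ ∪ P₃ ∪ Q₃ ∪ N₃, D1, E1, ?_, by omega, by omega, ?_, ?_, ?_, ?_⟩
  · clear key u1 u2 D1 D2 D3 D4 D5 D6 E1 E2 E3 E4 E5 E6
    rw [disjoint_left] at *
    simp only [subset_iff, mem_inter, mem_sdiff, mem_union, not_or] at *
    grind
  · rw [D3]; omega
  · rw [D3] at u1; omega
  · rw [E4]; omega
  · rw [E4] at u2; omega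

/-- The `i` common elements are divided according to the parts containing them: `j` in `P₁ ∩ Q₁`,
`k` in `P₂ ∩ Q₂`, `x` in `P₁ ∩ Q₂` and `y` in `P₂ ∩ Q₁`. -/
theorem exists_split_sizes {i a b c d lo₁ lo₂ W₁ W₂ : ℕ} (h1 : lo₁ ≤ a) (h1' : lo₁ ≤ b)
    (h1W : lo₁ + W₁ ≤ a + b) (h2 : lo₂ ≤ c) (h2' : lo₂ ≤ d) (h2W : lo₂ + W₂ ≤ c + d)
    (hlo : lo₁ + lo₂ ≤ i) (hW : i + W₁ + lo₂ ≤ a + b + c + d) (hW' : i + lo₁ + W₂ ≤ a + b + c + d)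
    (hi : i ≤ a + c) (hi' : i ≤ b + d) :
    ∃ j k x y, i = j + k + x + y ∧ lo₁ ≤ j ∧ j + W₁ ≤ a + b ∧ lo₂ ≤ k ∧ k + W₂ ≤ c + d ∧
      j + x ≤ a ∧ j + y ≤ b ∧ k + y ≤ c ∧ k + x ≤ d := by
  obtain ⟨j, hj, hj', hj''⟩ : ∃ j, lo₁ ≤ j ∧ lo₂ + i ≤ j + c + d ∧
      (j = lo₁ ∨ lo₂ + i = j + c + d) := ⟨max lo₁ (lo₂ + i - (c + d)), by omega⟩
  obtain ⟨k, hk, hk', hk''⟩ : ∃ k, lo₂ ≤ k ∧ lo₁ + i ≤ k + a + b ∧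
      (k = lo₂ ∨ lo₁ + i = k + a + b) := ⟨max lo₂ (lo₁ + i - (a + b)), by omega⟩
  obtain ⟨x, hx, hx1, hx2, hx'⟩ : ∃ x, j + k + x ≤ i ∧ j + x ≤ a ∧ k + x ≤ d ∧
      (j + k + x = i ∨ j + x = a ∨ k + x = d) :=
    ⟨min (i - j - k) (min (a - j) (d - k)), by omega⟩
  exact ⟨j, k, x, i - j - k - x, by omega⟩

theorem exists_split {ι : Type*} [DecidableEq ι] {P Q : Finset ι} {a b c d lo₁ lo₂ W₁ W₂ : ℕ}
    (hP : #P = a + c) (hQ : #Q = b + d) (h1 : lo₁ ≤ a) (h1' : lo₁ ≤ b)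
    (h1W : lo₁ + W₁ ≤ a + b) (h2 : lo₂ ≤ c) (h2' : lo₂ ≤ d) (h2W : lo₂ + W₂ ≤ c + d)
    (hlo : lo₁ + lo₂ ≤ #(P ∩ Q)) (hW : W₁ + lo₂ ≤ #(P ∪ Q)) (hW' : lo₁ + W₂ ≤ #(P ∪ Q)) :
    ∃ P₁ P₂ Q₁ Q₂, P₁ ⊆ P ∧ P₂ ⊆ P ∧ Disjoint P₁ P₂ ∧ Q₁ ⊆ Q ∧ Q₂ ⊆ Q ∧ Disjoint Q₁ Q₂ ∧
      #P₁ = a ∧ #P₂ = c ∧ #Q₁ = b ∧ #Q₂ = d ∧ lo₁ ≤ #(P₁ ∩ Q₁) ∧ W₁ ≤ #(P₁ ∪ Q₁) ∧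
      lo₂ ≤ #(P₂ ∩ Q₂) ∧ W₂ ≤ #(P₂ ∪ Q₂) := by
  have cPQ := card_union_add_card_inter P Q
  have cP := card_inter_add_card_sdiff P Q
  have cQ := card_inter_add_card_sdiff Q P
  rw [inter_comm] at cQ
  obtain ⟨j, k, x, y, hi, e1, e2, e3, e4, e5, e6, e7, e8⟩ := exists_split_sizes
    (i := #(P ∩ Q)) h1 h1' h1W h2 h2' h2W hlo (by omega) (by omega) (by omega) (by omega)
  obtain ⟨T, T', hT, hT', dT, cT, cT'⟩ := exists_two_subsets (P ∩ Q) (m := j + x) (n := k + y)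
    (by omega)
  obtain ⟨J, X, hJ, hX, dJ, cJ, cX⟩ := exists_two_subsets T (m := j) (n := x) (by omega)
  obtain ⟨I, Y, hI, hY, dI, cI, cY⟩ := exists_two_subsets T' (m := k) (n := y) (by omega)
  obtain ⟨A, C, hA, hC, dA, cA, cC⟩ := exists_two_subsets (P \ Q) (m := a - j - x) (n := c - k - y)
    (by omega)
  obtain ⟨B, D, hB, hD, dB, cB, cD⟩ := exists_two_subsets (Q \ P) (m := b - j - y) (n := d - k - x)
    (by omega)
  have key : ∀ J X Y A B : Finset ι, J ⊆ P ∩ Q → X ⊆ P ∩ Q → Y ⊆ P ∩ Q → A ⊆ P \ Q → B ⊆ Q \ P →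
      Disjoint J X → Disjoint J Y → Disjoint X Y →
      (J ∪ X ∪ A ⊆ P) ∧ (J ∪ Y ∪ B ⊆ Q) ∧ #(J ∪ X ∪ A) = #J + #X + #A ∧
      #(J ∪ Y ∪ B) = #J + #Y + #B ∧ (J ∪ X ∪ A) ∩ (J ∪ Y ∪ B) = J := by
    clear * -
    intro J X Y A B hJ hX hY hA hB d1 d2 d3
    rw [disjoint_left] at d1 d2 d3
    simp only [subset_iff, mem_inter, mem_sdiff, mem_union] at *
    refine ⟨by grind, by grind, ?_, ?_, by ext; grind⟩
    · rw [card_union_of_disjoint, card_union_of_disjoint] <;> rw [disjoint_left] <;> grind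
    · rw [card_union_of_disjoint, card_union_of_disjoint] <;> rw [disjoint_left] <;> grind
  have dd : ∀ {U U' : Finset ι}, U ⊆ T → U' ⊆ T' → Disjoint U U' := fun h h' =>
    disjoint_of_subset_left h (disjoint_of_subset_right h' dT)
  obtain ⟨a1, a2, a3, a4, a5⟩ := key J X Y A B (hJ.trans hT) (hX.trans hT) (hY.trans hT') hA hB dJ
    (dd hJ hY) (dd hX hY)
  obtain ⟨b1, b2, b3, b4, b5⟩ := key I Y X C D (hI.trans hT') (hY.trans hT') (hX.trans hT) hC hD dI
    (dd hX hI).symm (dd hX hY).symm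
  have u1 := card_union_add_card_inter (J ∪ X ∪ A) (J ∪ Y ∪ B)
  have u2 := card_union_add_card_inter (I ∪ Y ∪ C) (I ∪ X ∪ D)
  rw [a5] at u1
  rw [b5] at u2
  have d1 := dd hJ hI
  have d2 := dd hJ hY
  have d3 := dd hX hI
  have d4 := dd hX hY
  refine ⟨J ∪ X ∪ A, I ∪ Y ∪ C, J ∪ Y ∪ B, I ∪ X ∪ D, a1, b1, ?_, a2, b2, ?_, by omega, by omega,
    by omega, by omega, by rw [a5]; omega, by omega, by rw [b5]; omega, by omega⟩
  all_goals
    clear key dd u1 u2 a1 a2 a3 a4 a5 b1 b2 b3 b4 b5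
    rw [disjoint_left] at *
    simp only [subset_iff, mem_inter, mem_sdiff, mem_union] at *
    grind

end FiniteSets

/-! ### Squares, links and flows -/

variable {V : Type*}

theorem square_adj_of_adj {G : SimpleGraph V} {u v : V} (h : G.Adj u v) : (square G).Adj u v :=
  .inl (SimpleGraph.dist_eq_one_iff_adj.2 h)

theorem square_adj_of_common {G : SimpleGraph V} {u v w : V} (hu : G.Adj w u) (hv : G.Adj w v)
    (h : u ≠ v) : (square G).Adj u v := by
  have h1 : G.dist u v ≤ 2 := SimpleGraph.dist_le (.cons hu.symm (.cons hv .nil))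
  have h2 : 0 < G.dist u v := (hu.symm.reachable.trans hv.reachable).pos_dist_of_ne h
  change _ = 1 ∨ _ = 2
  omega

theorem square_adj_iff {G : SimpleGraph V} {u v : V} :
    (square G).Adj u v ↔ G.Adj u v ∨ u ≠ v ∧ ∃ w, G.Adj w u ∧ G.Adj w v := by
  refine ⟨?_, ?_⟩
  · rintro (h | h)
    · exact .inl (SimpleGraph.dist_eq_one_iff_adj.1 h)
    · refine .inr ⟨fun e => by simp [e] at h, ?_⟩
      obtain ⟨p, hp⟩ := SimpleGraph.Reachable.exists_walk_length_eq_dist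
        (SimpleGraph.Reachable.of_dist_ne_zero (G := G) (u := u) (v := v) (by omega))
      rw [h] at hp
      match p, hp with
      | .cons h₁ (.cons h₂ .nil), _ => exact ⟨_, h₁.symm, h₂⟩
  · rintro (h | ⟨h, w, hu, hv⟩)
    · exact square_adj_of_adj h
    · exact square_adj_of_common hu hv h

/-- `B` is connected in the square of `G` and meets the neighbourhoods of both `u` and `v`. -/
structure IsLink (G : SimpleGraph V) (u v : V) (B : Set V) : Prop where
  connected : ((square G).induce B).Connected
  left : ∃ x ∈ B, G.Adj u x
  right : ∃ x ∈ B, G.Adj v x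

theorem IsLink.symm {G : SimpleGraph V} {u v : V} {B : Set V} (h : IsLink G u v B) :
    IsLink G v u B := ⟨h.connected, h.right, h.left⟩

/-- The two links contain distinct neighbours of `c`, which are adjacent in the square. -/
theorem IsLink.trans {G : SimpleGraph V} {u v c : V} {B C : Set V} (h : IsLink G u c B)
    (h' : IsLink G c v C) (hd : Disjoint B C) : IsLink G u v (B ∪ C) := by
  obtain ⟨x, hx, hux⟩ := h.left
  obtain ⟨y, hy, hcy⟩ := h.right
  obtain ⟨z, hz, hcz⟩ := h'.left
  obtain ⟨w, hw, hvw⟩ := h'.right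
  have hyz : y ≠ z := fun e => Set.disjoint_left.1 hd hy (e ▸ hz)
  refine ⟨?_, ⟨x, .inl hx, hux⟩, ⟨w, .inr hw, hvw⟩⟩
  exact SimpleGraph.connected_induce_union h.connected.preconnected h'.connected.preconnected hy hz
    (square_adj_of_common hcy hcz hyz)

/-- There are `n` pairwise disjoint links between `u` and `v` inside `X`. -/
def Flow (G : SimpleGraph V) (u v : V) (X : Set V) (n : ℕ) : Prop :=
  ∃ B : Fin n → Set V, (∀ i, B i ⊆ X) ∧ (∀ i j, i ≠ j → Disjoint (B i) (B j)) ∧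
    ∀ i, IsLink G u v (B i)

namespace Flow

variable {G : SimpleGraph V} {u v c : V} {X Y : Set V} {m n : ℕ}

theorem mono (h : Flow G u v X n) (hX : X ⊆ Y) (hm : m ≤ n) : Flow G u v Y m := by
  obtain ⟨B, h1, h2, h3⟩ := h
  exact ⟨fun i => B (Fin.castLE hm i), fun i => (h1 _).trans hX,
    fun i j hij => h2 _ _ fun e => hij (Fin.castLE_injective hm e), fun i => h3 _⟩

theorem symm (h : Flow G u v X n) : Flow G v u X n := by
  obtain ⟨B, h1, h2, h3⟩ := h
  exact ⟨B, h1, h2, fun i => (h3 i).symm⟩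

theorem zero : Flow G u v X 0 :=
  ⟨fun i => i.elim0, fun i => i.elim0, fun i => i.elim0, fun i => i.elim0⟩

theorem single {p : V} (hu : G.Adj u p) (hv : G.Adj v p) : Flow G u v {p} 1 :=
  ⟨fun _ => {p}, fun _ => subset_rfl, fun i j h => (h (Subsingleton.elim i j)).elim,
    fun _ => ⟨by
      have : Nonempty ({p} : Set V) := ⟨⟨p, rfl⟩⟩
      exact ⟨SimpleGraph.Preconnected.of_subsingleton⟩, ⟨p, rfl, hu⟩, ⟨p, rfl, hv⟩⟩⟩

theorem add (h : Flow G u v X m) (h' : Flow G u v Y n) (hd : Disjoint X Y) :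
    Flow G u v (X ∪ Y) (m + n) := by
  obtain ⟨B, h1, h2, h3⟩ := h
  obtain ⟨C, h1', h2', h3'⟩ := h'
  refine ⟨Fin.append B C, fun i => ?_, fun i j => ?_, fun i => ?_⟩
  · refine Fin.addCases (fun i => ?_) (fun i => ?_) i
    · simpa using (h1 i).trans Set.subset_union_left
    · simpa using (h1' i).trans Set.subset_union_right
  · refine Fin.addCases (fun i => ?_) (fun i => ?_) i <;>
      refine Fin.addCases (fun j => ?_) (fun j => ?_) j <;> intro hij
    · simpa using h2 i j fun e => hij (e ▸ rfl)
    · simpa using hd.mono (h1 i) (h1' j)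
    · simpa using (hd.mono (h1 j) (h1' i)).symm
    · simpa using h2' i j fun e => hij (e ▸ rfl)
  · refine Fin.addCases (fun i => ?_) (fun i => ?_) i
    · simpa using h3 i
    · simpa using h3' i

theorem trans (h : Flow G u c X m) (h' : Flow G c v Y n) (hd : Disjoint X Y) :
    Flow G u v (X ∪ Y) (min m n) := by
  obtain ⟨B, h1, h2, h3⟩ := h.mono subset_rfl (min_le_left m n)
  obtain ⟨C, h1', h2', h3'⟩ := h'.mono subset_rfl (min_le_right m n)
  refine ⟨fun i => B i ∪ C i, fun i => Set.union_subset_union (h1 i) (h1' i), fun i j hij => ?_,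
    fun i => (h3 i).trans (h3' i) (hd.mono (h1 i) (h1' i))⟩
  rw [Set.disjoint_union_left, Set.disjoint_union_right, Set.disjoint_union_right]
  exact ⟨⟨h2 i j hij, hd.mono (h1 i) (h1' j)⟩, (hd.mono (h1 j) (h1' i)).symm, h2' i j hij⟩

/-- Disjoint links contain distinct neighbours of `u`. -/
theorem le_ncard [Finite V] (h : Flow G u v X n) : n ≤ (X ∩ G.neighborSet u).ncard := by
  obtain ⟨B, h1, h2, h3⟩ := h
  choose x hx hux using fun i => (h3 i).left
  have hinj : Function.Injective x := fun i j e => by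
    by_contra hij
    exact Set.disjoint_left.1 (h2 i j hij) (hx i) (e ▸ hx j)
  calc n = (Set.range x).ncard := by
        rw [← Set.image_univ, Set.ncard_image_of_injective _ hinj, Set.ncard_univ]; simp
    _ ≤ _ := Set.ncard_le_ncard (by
        rintro _ ⟨i, rfl⟩
        exact ⟨h1 i (hx i), hux i⟩)

end Flow

/-! ### What hangs at an edge, and merging across a triangle -/

section Sides

variable {V : Type*}

/-- `G` has no vertex of degree at least `K`, and no triangle together with `K - 2` disjoint links
between its vertices. -/
structure LinkBounded (G : SimpleGraph V) (K : ℕ) : Prop where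
  degree : ∀ v, (G.neighborSet v).ncard + 1 ≤ K
  triangle : ∀ {u v d : V} {X₁ X₂ X₃ : Set V} {m₁ m₂ m₃ : ℕ}, G.Adj u v → G.Adj u d → G.Adj v d →
    Disjoint X₁ X₂ → Disjoint X₁ X₃ → Disjoint X₂ X₃ → u ∉ X₁ ∪ X₂ ∪ X₃ → v ∉ X₁ ∪ X₂ ∪ X₃ →
    d ∉ X₁ ∪ X₂ ∪ X₃ → Flow G u v X₁ m₁ → Flow G u d X₂ m₂ → Flow G v d X₃ m₃ →
    m₁ + m₂ + m₃ + 3 ≤ K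

/-- Numerical data of a set `D` of vertices hanging at the edge `uv`. -/
structure EdgeValid (G : SimpleGraph V) (K : ℕ) (u v : V) (D : Set V) (a b f lo W : ℕ) :
    Prop where
  left_le : a ≤ (D ∩ G.neighborSet u).ncard
  right_le : b ≤ (D ∩ G.neighborSet v).ncard
  flow : Flow G u v D f
  bounds : ∀ {φ}, Flow G u v (insert u (insert v D))ᶜ φ → SideBounds (K - 2) a b f lo W φ

theorem SideBounds.symm {K a b f lo W φ : ℕ} (h : SideBounds K a b f lo W φ) : SideBounds K b a f lo W φ := by
  obtain ⟨h1, h2, h3, h4, h5, h6, h7⟩ := h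
  constructor <;> omega

theorem EdgeValid.symm {G : SimpleGraph V} {K : ℕ} {u v : V} {D : Set V} {a b f lo W : ℕ}
    (h : EdgeValid G K u v D a b f lo W) : EdgeValid G K v u D b a f lo W :=
  ⟨h.right_le, h.left_le, h.flow.symm, fun hφ => by
    rw [Set.insert_comm] at hφ
    exact (h.bounds hφ.symm).symm⟩

theorem ncard_inter_union [Finite V] {X Y N : Set V} (h : Disjoint X Y) :
    ((X ∪ Y) ∩ N).ncard = (X ∩ N).ncard + (Y ∩ N).ncard := by
  rw [Set.union_inter_distrib_right, Set.ncard_union_eq]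
  exact h.mono Set.inter_subset_left Set.inter_subset_left

theorem ncard_singleton_inter {N : Set V} {p : V} (h : p ∈ N) : ({p} ∩ N).ncard = 1 := by
  rw [Set.inter_eq_left.2 (by simpa using h), Set.ncard_singleton]

/-- The degree bounds at `x`, `y`, `p` and the triangle bound for `xyp` are the inputs of
`SideBounds.triangle`; `SideBounds.add` then joins the block of `p` to what already hangs at `xy`.
The block's own bounds are kept as well, since they are needed when `p` is put back. -/
theorem EdgeValid.contract [Finite V] {G : SimpleGraph V} {K : ℕ} (hG : LinkBounded G K)
    {x y p : V} {D₁ D₂ D₃ : Set V} {a₁ b₁ f₁ lo₁ W₁ a₂ d₂ f₂ lo₂ W₂ b₃ d₃ f₃ lo₃ W₃ : ℕ}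
    (hxy : G.Adj x y) (hxp : G.Adj x p) (hyp : G.Adj y p)
    (h1 : EdgeValid G K x y D₁ a₁ b₁ f₁ lo₁ W₁) (h2 : EdgeValid G K x p D₂ a₂ d₂ f₂ lo₂ W₂)
    (h3 : EdgeValid G K y p D₃ b₃ d₃ f₃ lo₃ W₃)
    (h12 : Disjoint D₁ D₂) (h13 : Disjoint D₁ D₃) (h23 : Disjoint D₂ D₃)
    (hx : x ∉ D₁ ∪ D₂ ∪ D₃) (hy : y ∉ D₁ ∪ D₂ ∪ D₃) (hp : p ∉ D₁ ∪ D₂ ∪ D₃) :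
    EdgeValid G K x y (D₁ ∪ ({p} ∪ (D₂ ∪ D₃))) (a₁ + (1 + a₂)) (b₁ + (1 + b₃))
      (f₁ + (1 + min f₂ f₃)) (lo₁ + (1 + max (lo₂ + W₃ - (K - 3)) (W₂ + lo₃ - (K - 3))))
      (max (W₁ + (1 + max (lo₂ + W₃ - (K - 3)) (W₂ + lo₃ - (K - 3))))
        (lo₁ + (1 + max (lo₂ + lo₃) (W₂ + W₃ - (K - 3))))) ∧
    SideBounds (K - 2) (1 + a₂) (1 + b₃) (1 + min f₂ f₃)
      (1 + max (lo₂ + W₃ - (K - 3)) (W₂ + lo₃ - (K - 3)))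
      (1 + max (lo₂ + lo₃) (W₂ + W₃ - (K - 3))) 0 ∧ d₂ + d₃ + 3 ≤ K := by
  have hpD : p ∉ D₂ ∪ D₃ := fun h => hp (by simp at h ⊢; tauto)
  have dp : Disjoint {p} (D₂ ∪ D₃) := by simpa using hpD
  have d1 : Disjoint D₁ ({p} ∪ (D₂ ∪ D₃)) := by
    simp only [Set.disjoint_union_right, Set.disjoint_singleton_right]
    exact ⟨fun h => hp (by simp [h]), h12, h13⟩
  have hflow : Flow G x y ({p} ∪ (D₂ ∪ D₃)) (1 + min f₂ f₃) :=
    (Flow.single hxp hyp).add (h2.flow.trans h3.flow.symm h23) dp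
  have cnt : ∀ {z : V} {X Y Z : Set V} {q : V}, G.Adj z q → G.Adj z p → q ≠ p → Disjoint X Y →
      Disjoint (X ∪ Y) Z → q ∉ X ∪ Y ∪ Z → p ∉ X ∪ Y ∪ Z →
      (X ∩ G.neighborSet z).ncard + (Y ∩ G.neighborSet z).ncard + (Z ∩ G.neighborSet z).ncard + 3
        ≤ K := by
    intro z X Y Z q hq hp' hqp hXY hZ hq' hp''
    have e1 := ncard_inter_union (N := G.neighborSet z) hXY
    have e2 := ncard_inter_union (N := G.neighborSet z) hZ
    have e3 := ncard_inter_union (N := G.neighborSet z) (X := X ∪ Y ∪ Z) (Y := {q})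
      (by simpa using hq')
    have e4 := ncard_inter_union (N := G.neighborSet z) (X := X ∪ Y ∪ Z ∪ {q}) (Y := {p}) (by
      simp only [Set.disjoint_singleton_right] at hp'' ⊢
      simp only [Set.mem_union, Set.mem_singleton_iff] at hp'' ⊢
      grind)
    have s1 := ncard_singleton_inter (N := G.neighborSet z) hq
    have s2 := ncard_singleton_inter (N := G.neighborSet z) hp'
    have le := Set.ncard_le_ncard (Set.inter_subset_right (s := X ∪ Y ∪ Z ∪ {q} ∪ {p})
      (t := G.neighborSet z))
    have := hG.degree z
    omega
  have hd : d₂ + d₃ + 3 ≤ K := by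
    have e := ncard_inter_union (N := G.neighborSet p) h23
    have e1 := ncard_inter_union (N := G.neighborSet p) (X := D₂ ∪ D₃) (Y := {x})
      (by simp at hx ⊢; tauto)
    have e2 := ncard_inter_union (N := G.neighborSet p) (X := D₂ ∪ D₃ ∪ {x}) (Y := {y})
      (by have := hxy.ne'; simp at hy ⊢; tauto)
    have s1 := ncard_singleton_inter (N := G.neighborSet p) hxp.symm
    have s2 := ncard_singleton_inter (N := G.neighborSet p) hyp.symm
    have le := Set.ncard_le_ncard (Set.inter_subset_right (s := D₂ ∪ D₃ ∪ {x} ∪ {y})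
      (t := G.neighborSet p))
    have := hG.degree p
    have := h2.right_le
    have := h3.right_le
    omega
  have main : ∀ {φ}, Flow G x y (insert x (insert y (D₁ ∪ ({p} ∪ (D₂ ∪ D₃)))))ᶜ φ →
      φ + a₁ + (1 + a₂) ≤ K - 2 ∧ φ + b₁ + (1 + b₃) ≤ K - 2 ∧
      SideBounds (K - 2) a₁ b₁ f₁ lo₁ W₁ (φ + (1 + min f₂ f₃)) ∧
      SideBounds (K - 2) (1 + a₂) (1 + b₃) (1 + min f₂ f₃)
      (1 + max (lo₂ + W₃ - (K - 3)) (W₂ + lo₃ - (K - 3)))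
      (1 + max (lo₂ + lo₃) (W₂ + W₃ - (K - 3))) (φ + f₁) := by
    intro φ hφ
    obtain ⟨X, hX⟩ : ∃ X, X = (insert x (insert y (D₁ ∪ ({p} ∪ (D₂ ∪ D₃)))))ᶜ := ⟨_, rfl⟩
    rw [← hX] at hφ
    have X1 : Disjoint X D₁ := by rw [Set.disjoint_left, hX]; simp; tauto
    have X2 : Disjoint X D₂ := by rw [Set.disjoint_left, hX]; simp; tauto
    have X3 : Disjoint X D₃ := by rw [Set.disjoint_left, hX]; simp
    have Xp : p ∉ X := by rw [hX]; simp
    have Xx : x ∉ X := by rw [hX]; simp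
    have Xy : y ∉ X := by rw [hX]; simp
    have Y2 : Disjoint (X ∪ D₁) D₂ := Set.disjoint_union_left.2 ⟨X2, h12⟩
    have Y3 : Disjoint (X ∪ D₁) D₃ := Set.disjoint_union_left.2 ⟨X3, h13⟩
    have hφ₁ := hφ.add h1.flow X1
    have T := hG.triangle hxy hxp hyp Y2 Y3 h23 (by simp at hx ⊢; tauto) (by simp at hy ⊢; tauto)
      (by simp at hp ⊢; tauto) hφ₁ h2.flow h3.flow
    have cx := cnt hxy hxp hyp.ne X1 Y2 (by simp at hy ⊢; tauto) (by simp at hp ⊢; tauto)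
    have cy := cnt hxy.symm hyp hxp.ne X1 Y3 (by simp at hx ⊢; tauto) (by simp at hp ⊢; tauto)
    have l1 := hφ.le_ncard
    have l2 := hφ.symm.le_ncard
    have l3 := hφ₁.le_ncard
    have l4 := hφ₁.symm.le_ncard
    rw [ncard_inter_union X1] at l3 l4
    have := h1.left_le
    have := h1.right_le
    have := h2.left_le
    have := h3.left_le
    refine ⟨by omega, by omega, h1.bounds ((hφ.add hflow ?_).mono ?_ le_rfl), ?_⟩
    · simp only [Set.disjoint_union_right, Set.disjoint_singleton_right]
      exact ⟨Xp, X2, X3⟩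
    · rw [hX]
      intro z
      have := hxp.ne
      have := hyp.ne
      rw [Set.disjoint_left] at h12 h13
      simp only [Set.mem_union, Set.mem_compl_iff, Set.mem_insert_iff, Set.mem_singleton_iff] at *
      grind
    · obtain ⟨k, rfl⟩ : ∃ k, K = k + 3 := ⟨K - 3, by omega⟩
      -- For the side at `xp`, the outside links are `{y}` and the `x`–`y` links (outside ones and
      -- those in `D₁`) continued through `D₃`.
      have b2 := h2.bounds (φ := 1 + min (φ + f₁) f₃) (((Flow.single hxy hyp.symm).add
        (hφ₁.trans h3.flow Y3) ?_).mono ?_ le_rfl)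
      have b3 := h3.bounds (φ := 1 + min (φ + f₁) f₂) (((Flow.single hxy.symm hxp.symm).add
        (hφ₁.symm.trans h2.flow Y2) ?_).mono ?_ le_rfl)
      · exact SideBounds.triangle (K := k) (by omega) (by omega) (by omega) (by omega) b2 b3
      · simp at hx ⊢; tauto
      · intro z
        have := hxp.ne
        have := hxy.ne
        rw [Set.disjoint_left] at Y2 h23
        simp only [Set.mem_union, Set.mem_compl_iff, Set.mem_insert_iff,
          Set.mem_singleton_iff] at *
        grind
      · simp at hy ⊢; tauto
      · intro z
        have := hyp.ne
        have := hxy.ne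
        rw [Set.disjoint_left] at Y3 h23
        simp only [Set.mem_union, Set.mem_compl_iff, Set.mem_insert_iff,
          Set.mem_singleton_iff] at *
        grind
  refine ⟨⟨?_, ?_, h1.flow.add hflow d1, fun {φ} hφ => ?_⟩, ?_, hd⟩
  · have e1 := ncard_inter_union (N := G.neighborSet x) d1
    have e2 := ncard_inter_union (N := G.neighborSet x) dp
    have e3 := ncard_inter_union (N := G.neighborSet x) h23
    have s1 := ncard_singleton_inter (N := G.neighborSet x) hxp
    have := h1.left_le
    have := h2.left_le
    omega
  · have e1 := ncard_inter_union (N := G.neighborSet y) d1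
    have e2 := ncard_inter_union (N := G.neighborSet y) dp
    have e3 := ncard_inter_union (N := G.neighborSet y) h23
    have s1 := ncard_singleton_inter (N := G.neighborSet y) hyp
    have := h1.right_le
    have := h3.left_le
    omega
  · obtain ⟨hx', hy', hs1, hs2⟩ := main hφ
    exact SideBounds.add hx' hy' hs1 hs2
  · obtain ⟨-, -, -, hs⟩ := main Flow.zero
    obtain ⟨q1, q2, q3, q4, q5, q6, q7⟩ := hs
    constructor <;> omega

end Sides

/-! ### Decorations and palettes -/

section Palettes

open Finset

variable {V : Type*}

/-- Numerical data of vertex sets hanging at the edges of a graph. -/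
structure Decoration (V : Type*) where
  D : Sym2 V → Set V
  a : V → V → ℕ
  f : Sym2 V → ℕ
  lo : Sym2 V → ℕ
  W : Sym2 V → ℕ

structure IsDecoration (G : SimpleGraph V) (K : ℕ) (S : Set V) (δ : Decoration V) : Prop where
  valid : ∀ {u v}, u ∈ S → v ∈ S → G.Adj u v →
    EdgeValid G K u v (δ.D s(u, v)) (δ.a u v) (δ.a v u) (δ.f s(u, v)) (δ.lo s(u, v)) (δ.W s(u, v))
  out : ∀ {u v w}, u ∈ S → v ∈ S → G.Adj u v → w ∈ S → w ∉ δ.D s(u, v)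
  disj : ∀ {u v w x}, u ∈ S → v ∈ S → G.Adj u v → w ∈ S → x ∈ S → G.Adj w x →
    s(u, v) ≠ s(w, x) → Disjoint (δ.D s(u, v)) (δ.D s(w, x))

/-- A colouring `c` of the square of `G[S]` together with, at each pair of adjacent vertices
`u`, `v`, the set `A u v` of the colours of the neighbours of `u` hanging at the edge `uv`. -/
structure IsPalette (G : SimpleGraph V) (S : Set V) (δ : Decoration V) {K : ℕ} (c : V → Fin K)
    (A : V → V → Finset (Fin K)) : Prop where
  own : ∀ {u v}, u ∈ S → v ∈ S → G.Adj u v → c u ∉ insert (c v) (A u v)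
  nbr : ∀ {u v}, u ∈ S → v ∈ S → G.Adj u v → c v ∉ A u v
  disj : ∀ {u v w}, u ∈ S → v ∈ S → w ∈ S → G.Adj u v → G.Adj u w → v ≠ w →
    Disjoint (insert (c v) (A u v)) (insert (c w) (A u w))
  card : ∀ {u v}, u ∈ S → v ∈ S → G.Adj u v → #(A u v) = δ.a u v
  inter : ∀ {u v}, u ∈ S → v ∈ S → G.Adj u v → δ.lo s(u, v) ≤ #(A u v ∩ A v u)
  union : ∀ {u v}, u ∈ S → v ∈ S → G.Adj u v → δ.W s(u, v) ≤ #(A u v ∪ A v u)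

theorem IsDecoration.mono {G : SimpleGraph V} {K : ℕ} {S T : Set V} {δ : Decoration V}
    (h : IsDecoration G K S δ) (hT : T ⊆ S) : IsDecoration G K T δ :=
  ⟨fun hu hv => h.valid (hT hu) (hT hv), fun hu hv ha hw => h.out (hT hu) (hT hv) ha (hT hw),
    fun hu hv ha hw hx => h.disj (hT hu) (hT hv) ha (hT hw) (hT hx)⟩

/-- Extending a palette by a vertex `p`. The colour sets at the old edges may shrink. -/
theorem IsPalette.extend {G : SimpleGraph V} {S : Set V} {δ δ' : Decoration V} {K : ℕ}
    {c c' : V → Fin K} {A A' : V → V → Finset (Fin K)} (h : IsPalette G S δ c A) {p : V}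
    (hc : ∀ {z}, z ∈ S → c' z = c z)
    (hA : ∀ {z w}, z ∈ S → w ∈ S → G.Adj z w → A' z w ⊆ A z w)
    (own : ∀ {z}, z ∈ S → G.Adj z p →
      c' p ∉ insert (c z) (A' p z) ∧ c z ∉ insert (c' p) (A' z p))
    (nbr : ∀ {z}, z ∈ S → G.Adj z p → c z ∉ A' p z ∧ c' p ∉ A' z p)
    (disj : ∀ {v w}, v ∈ S → w ∈ S → G.Adj p v → G.Adj p w → v ≠ w →
      Disjoint (insert (c v) (A' p v)) (insert (c w) (A' p w)))
    (disj' : ∀ {z w}, z ∈ S → w ∈ S → G.Adj z w → G.Adj z p →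
      Disjoint (insert (c w) (A' z w)) (insert (c' p) (A' z p)))
    (num : ∀ {u v}, u ∈ S → v ∈ S → G.Adj u v → #(A' u v) = δ'.a u v ∧
      δ'.lo s(u, v) ≤ #(A' u v ∩ A' v u) ∧ δ'.W s(u, v) ≤ #(A' u v ∪ A' v u))
    (num' : ∀ {z}, z ∈ S → G.Adj z p → #(A' z p) = δ'.a z p ∧ #(A' p z) = δ'.a p z ∧
      δ'.lo s(z, p) ≤ #(A' z p ∩ A' p z) ∧ δ'.W s(z, p) ≤ #(A' z p ∪ A' p z)) :
    IsPalette G (insert p S) δ' c' A' where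
  own := by
    rintro u v (rfl | hu) (rfl | hv) huv
    · exact (huv.ne rfl).elim
    · rw [hc hv]; exact (own hv huv.symm).1
    · rw [hc hu]; exact (own hu huv).2
    · rw [hc hu, hc hv]
      exact fun hm => h.own hu hv huv (insert_subset_insert _ (hA hu hv huv) hm)
  nbr := by
    rintro u v (rfl | hu) (rfl | hv) huv
    · exact (huv.ne rfl).elim
    · rw [hc hv]; exact (nbr hv huv.symm).1
    · exact (nbr hu huv).2
    · rw [hc hv]
      exact fun hm => h.nbr hu hv huv (hA hu hv huv hm)
  disj := by
    rintro u v w (rfl | hu) (rfl | hv) (rfl | hw) huv huw hvw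
    · exact (huv.ne rfl).elim
    · exact (huv.ne rfl).elim
    · exact (huw.ne rfl).elim
    · rw [hc hv, hc hw]; exact disj hv hw huv huw hvw
    · exact (hvw rfl).elim
    · rw [hc hw]; exact (disj' hu hw huw huv).symm
    · rw [hc hv]; exact disj' hu hv huv huw
    · rw [hc hv, hc hw]
      exact (h.disj hu hv hw huv huw hvw).mono (insert_subset_insert _ (hA hu hv huv))
        (insert_subset_insert _ (hA hu hw huw))
  card := by
    rintro u v (rfl | hu) (rfl | hv) huv
    · exact (huv.ne rfl).elim
    · exact (num' hv huv.symm).2.1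
    · exact (num' hu huv).1
    · exact (num hu hv huv).1
  inter := by
    rintro u v (rfl | hu) (rfl | hv) huv
    · exact (huv.ne rfl).elim
    · rw [Sym2.eq_swap, inter_comm]; exact (num' hv huv.symm).2.2.1
    · exact (num' hu huv).2.2.1
    · exact (num hu hv huv).2.1
  union := by
    rintro u v (rfl | hu) (rfl | hv) huv
    · exact (huv.ne rfl).elim
    · rw [Sym2.eq_swap, union_comm]; exact (num' hv huv.symm).2.2.2
    · exact (num' hu huv).2.2.2
    · exact (num hu hv huv).2.2

theorem exists_overlap {ι : Type*} [DecidableEq ι] {X P : Finset ι} (hP : P ⊆ X)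
    {b f lo W φ : ℕ} (hb : b ≤ #X) (h : SideBounds #X #P b f lo W φ) :
    ∃ Q ⊆ X, #Q = b ∧ lo ≤ #(P ∩ Q) ∧ W ≤ #(P ∪ Q) := by
  obtain ⟨-, h2, h3, h4, -, -, -⟩ := h
  have hc := card_sdiff_add_card_eq_card hP
  -- The overlap is taken as small as `lo` and the size of `X` permit, which makes the union as
  -- large as possible.
  obtain ⟨I, hI, cI⟩ := exists_subset_card_eq (s := P) (n := max lo (b - (#X - #P))) (by omega)
  obtain ⟨J, hJ, cJ⟩ := exists_subset_card_eq (s := X \ P) (n := b - max lo (b - (#X - #P)))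
    (by omega)
  have hd : Disjoint I J := disjoint_of_subset_left hI (disjoint_of_subset_right hJ disjoint_sdiff)
  have hQ := card_union_of_disjoint hd
  have hPQ : P ∩ (I ∪ J) = I := by
    ext z
    have := @hI z
    have := @hJ z
    simp only [mem_inter, mem_union, mem_sdiff] at *
    tauto
  have hu := card_union_add_card_inter P (I ∪ J)
  refine ⟨I ∪ J, union_subset (hI.trans hP) (hJ.trans sdiff_subset), by omega, ?_, ?_⟩
  · rw [hPQ]; omega
  · rw [hPQ] at hu; omega

theorem exists_palette_pair [Finite V] {G : SimpleGraph V} {K : ℕ} (hG : LinkBounded G K)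
    {u v : V} (huv : G.Adj u v) {δ : Decoration V} (hδ : IsDecoration G K {u, v} δ) :
    ∃ (c : V → Fin K) (A : V → V → Finset (Fin K)), IsPalette G {u, v} δ c A := by
  classical
  have hv := hδ.valid (by simp) (by simp) huv
  have hb := hv.bounds Flow.zero
  have deg : ∀ {x y : V} {a : ℕ} {D : Set V}, G.Adj x y → y ∉ D →
      a ≤ (D ∩ G.neighborSet x).ncard → a + 2 ≤ K := by
    intro x y a D hxy hy ha
    have e := ncard_inter_union (N := G.neighborSet x) (X := D) (Y := {y}) (by simpa using hy)
    have s := ncard_singleton_inter (N := G.neighborSet x) hxy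
    have le := Set.ncard_le_ncard (Set.inter_subset_right (s := D ∪ {y}) (t := G.neighborSet x))
    have := hG.degree x
    omega
  have ha := deg huv (hδ.out (by simp) (by simp) huv (by simp)) hv.left_le
  have hb' := deg huv.symm (hδ.out (by simp) (by simp) huv (by simp)) hv.right_le
  obtain ⟨p, hp⟩ : ∃ p : Fin K, p = ⟨0, by omega⟩ := ⟨_, rfl⟩
  obtain ⟨q, hq⟩ : ∃ q : Fin K, q = ⟨1, by omega⟩ := ⟨_, rfl⟩
  have hpq : p ≠ q := by rw [hp, hq]; simp
  obtain ⟨X, hX⟩ : ∃ X : Finset (Fin K), X = univ \ {p, q} := ⟨_, rfl⟩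
  have cX : #X = K - 2 := by
    rw [hX, card_sdiff_of_subset (subset_univ _), card_pair hpq]; simp
  obtain ⟨P, hP, cP⟩ := exists_subset_card_eq (s := X) (n := δ.a u v) (by omega)
  rw [← cX, ← cP] at hb
  obtain ⟨Q, hQ, cQ, hlo, hW⟩ := exists_overlap hP (by omega) hb
  have pP : p ∉ P := fun h => by simpa [hX] using hP h
  have qP : q ∉ P := fun h => by simpa [hX] using hP h
  have pQ : p ∉ Q := fun h => by simpa [hX] using hQ h
  have qQ : q ∉ Q := fun h => by simpa [hX] using hQ h
  have hne := huv.ne'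
  refine ⟨fun z => if z = u then p else q, fun z _ => if z = u then P else Q, ?_, ?_, ?_, ?_, ?_, ?_⟩
  · rintro x y (rfl | rfl) (rfl | rfl) hxy <;> simp_all
  · rintro x y (rfl | rfl) (rfl | rfl) hxy <;> simp_all
  · rintro x y z (rfl | rfl) (rfl | rfl) (rfl | rfl) hxy hxz hyz <;> simp_all
  · rintro x y (rfl | rfl) (rfl | rfl) hxy <;> simp_all
  · rintro x y (rfl | rfl) (rfl | rfl) hxy
    · simp_all
    · simpa [hne] using hlo
    · rw [Sym2.eq_swap, inter_comm]; simpa [hne] using hlo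
    · simp_all
  · rintro x y (rfl | rfl) (rfl | rfl) hxy
    · simp_all
    · simpa [hne] using hW
    · rw [Sym2.eq_swap, union_comm]; simpa [hne] using hW
    · simp_all

end Palettes

/-! ### Adding a pendant vertex -/

section PaletteExtension

open Finset

variable {V : Type*}

/-- The sets consisting of `v` and the neighbours of `u` hanging at `uv` are pairwise disjoint
inside the neighbourhood of `u`. -/
theorem IsDecoration.sum_le_degree [Finite V] {G : SimpleGraph V} {K : ℕ} {S : Set V}
    {δ : Decoration V} (hδ : IsDecoration G K S δ) {u : V} (hu : u ∈ S) (T : Finset V)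
    (hT : ∀ v ∈ T, v ∈ S ∧ G.Adj u v) :
    ∑ v ∈ T, (δ.a u v + 1) ≤ (G.neighborSet u).ncard := by
  classical
  suffices h : ∑ v ∈ T, (δ.a u v + 1) ≤
      (⋃ v ∈ T, insert v (δ.D s(u, v) ∩ G.neighborSet u)).ncard by
    refine h.trans (Set.ncard_le_ncard ?_)
    simp only [Set.iUnion_subset_iff, Set.insert_subset_iff]
    exact fun v hv => ⟨(hT v hv).2, Set.inter_subset_right⟩
  induction T using Finset.induction_on with
  | empty => simp
  | insert v T hv ih =>
    have ih := ih fun w hw => hT w (mem_insert_of_mem hw)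
    obtain ⟨hvS, huv⟩ := hT v (mem_insert_self v T)
    rw [sum_insert hv, set_biUnion_insert, Set.ncard_union_eq,
      Set.ncard_insert_of_notMem fun h => hδ.out hu hvS huv hvS h.1]
    · have := (hδ.valid hu hvS huv).left_le
      omega
    · rw [Set.disjoint_iUnion₂_right]
      intro w hw
      obtain ⟨hwS, huw⟩ := hT w (mem_insert_of_mem hw)
      have hvw : v ≠ w := fun e => hv (e ▸ hw)
      have h1 := hδ.out hu hvS huv hwS
      have h2 := hδ.out hu hwS huw hvS
      have h3 := Set.disjoint_left.1 (hδ.disj hu hvS huv hu hwS huw (by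
        intro e
        rcases Sym2.eq_iff.1 e with e | e
        · exact hvw e.2
        · exact huw.ne e.1))
      rw [Set.disjoint_left]
      simp only [Set.mem_insert_iff, Set.mem_inter_iff]
      rintro z (rfl | hz) (e | hz')
      · exact hvw e
      · exact h2 hz'.1
      · exact h1 (e ▸ hz.1)
      · exact h3 hz.1 hz'.1

theorem IsPalette.joinVertex [Finite V] {G : SimpleGraph V} {K : ℕ} (hG : LinkBounded G K)
    {S : Set V} {u w : V} (hw : w ∉ S) (hu : u ∈ S) (hadj : ∀ x ∈ S, G.Adj w x ↔ x = u)
    {δ : Decoration V} (hδ : IsDecoration G K (insert w S) δ) {c : V → Fin K}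
    {A : V → V → Finset (Fin K)} (h : IsPalette G S δ c A) :
    ∃ (c' : V → Fin K) (A' : V → V → Finset (Fin K)), IsPalette G (insert w S) δ c' A' := by
  classical
  have := Fintype.ofFinite V
  have hwu : G.Adj w u := (hadj u hu).2 rfl
  have hu' : u ∈ insert w S := .inr hu
  have hw' : w ∈ insert w S := .inl rfl
  have hval := hδ.valid hu' hw' hwu.symm
  have hb := hval.bounds Flow.zero
  obtain ⟨T, hT⟩ : ∃ T : Finset V, ∀ v, v ∈ T ↔ v ∈ S ∧ G.Adj u v :=
    ⟨univ.filter fun v => v ∈ S ∧ G.Adj u v, by simp⟩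
  have hsum := hδ.sum_le_degree hu' (insert w T) fun v hv => by
    rcases mem_insert.1 hv with rfl | hv
    · exact ⟨hw', hwu.symm⟩
    · exact ⟨.inr ((hT v).1 hv).1, ((hT v).1 hv).2⟩
  rw [sum_insert fun h => hw ((hT w).1 h).1] at hsum
  obtain ⟨U, hU⟩ : ∃ U, U = insert (c u) (T.biUnion fun v => insert (c v) (A u v)) := ⟨_, rfl⟩
  have cU : #U ≤ ∑ v ∈ T, (δ.a u v + 1) + 1 := by
    rw [hU]
    refine (card_insert_le _ _).trans (Nat.succ_le_succ (card_biUnion_le.trans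
      (sum_le_sum fun v hv => ?_)))
    refine (card_insert_le _ _).trans ?_
    rw [h.card hu ((hT v).1 hv).1 ((hT v).1 hv).2]
  have degu := hG.degree u
  have degw : δ.a w u + 2 ≤ K := by
    have := hδ.sum_le_degree hw' {u} (by simpa using ⟨.inr hu, hwu⟩)
    have := hG.degree w
    simp at this
    simp at *
    omega
  have hc : #(univ \ U) = K - #U := by rw [card_sdiff_of_subset (subset_univ _)]; simp
  -- The degree bound leaves enough colours unused around `u`: one for `w` and `δ.a u w` for what
  -- hangs at `uw`.
  obtain ⟨Z, hZ, cZ⟩ := exists_subset_card_eq (s := univ \ U) (n := δ.a u w + 1) (by omega)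
  obtain ⟨γ, hγ⟩ : ∃ γ, γ ∈ Z := card_pos.1 (by omega)
  have hZU : ∀ z ∈ Z, z ∉ U := fun z hz => (mem_sdiff.1 (hZ hz)).2
  obtain ⟨P, hP⟩ : ∃ P, P = Z.erase γ := ⟨_, rfl⟩
  have cP : #P = δ.a u w := by rw [hP, card_erase_of_mem hγ, cZ]; rfl
  have huγ : c u ≠ γ := fun e => hZU γ hγ (by rw [hU, e]; exact mem_insert_self _ _)
  obtain ⟨X, hX⟩ : ∃ X : Finset (Fin K), X = univ \ {c u, γ} := ⟨_, rfl⟩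
  have cX : #X = K - 2 := by
    rw [hX, card_sdiff_of_subset (subset_univ _), card_pair huγ]; simp
  have huP : c u ∉ P := fun h' => hZU (c u) (mem_of_mem_erase (hP ▸ h')) (by simp [hU])
  have hγP : γ ∉ P := by simp [hP]
  have hPX : P ⊆ X := fun z hz => by
    rw [hX]
    simp only [mem_sdiff, mem_univ, mem_insert, mem_singleton, true_and]
    rintro (rfl | rfl)
    · exact huP hz
    · exact hγP hz
  rw [← cX, ← cP] at hb
  obtain ⟨Q, hQ, cQ, hlo, hW⟩ := exists_overlap hPX (by omega) hb
  have huQ : c u ∉ Q := fun h => by simpa [hX] using hQ h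
  have hγQ : γ ∉ Q := fun h => by simpa [hX] using hQ h
  have hPZ : insert γ P ⊆ Z := by rw [hP, insert_erase hγ]
  have only : ∀ {z}, z ∈ S → G.Adj z w → z = u := fun hz hzw => (hadj _ hz).1 hzw.symm
  have ne : ∀ {z}, z ∈ S → z ≠ w := fun hz e => hw (e ▸ hz)
  refine ⟨fun z => if z = w then γ else c z,
    fun z v => if z = w then Q else if v = w then P else A z v,
    h.extend ?_ ?_ ?_ ?_ ?_ ?_ ?_ ?_⟩
  · intro z hz; simp [ne hz]
  · intro z v hz hv _; simp [ne hz, ne hv]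
  · intro z hz hzw
    obtain rfl := only hz hzw
    simp [ne hz, huP, hγQ, huγ, huγ.symm]
  · intro z hz hzw
    obtain rfl := only hz hzw
    simp [ne hz, huQ, hγP]
  · intro v v' hv hv' h1 h2 h3
    exact (h3 (((hadj _ hv).1 h1).trans ((hadj _ hv').1 h2).symm)).elim
  · intro z v hz hv hzv hzw
    obtain rfl := only hz hzw
    simp only [ne hz, ne hv, if_false, if_true]
    refine disjoint_of_subset_right hPZ (disjoint_left.2 fun x hx hx' => hZU x hx' ?_)
    rw [hU]
    exact mem_insert_of_mem (mem_biUnion.2 ⟨v, (hT v).2 ⟨hv, hzv⟩, hx⟩)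
  · intro z v hz hv hzv
    simp only [ne hz, ne hv, if_false]
    exact ⟨h.card hz hv hzv, h.inter hz hv hzv, h.union hz hv hzv⟩
  · intro z hz hzw
    obtain rfl := only hz hzw
    simp only [ne hz, if_false, if_true]
    exact ⟨cP, cQ, hlo, hW⟩

/-- Contraction of the vertex `p` hanging at the edge `xy` into the set hanging at `xy`. -/
noncomputable def Decoration.contract (δ : Decoration V) (K : ℕ) (x y p : V) : Decoration V := by
  classical
  exact
  { D := Function.update δ.D s(x, y) (δ.D s(x, y) ∪ ({p} ∪ (δ.D s(x, p) ∪ δ.D s(y, p))))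
    a := fun u v => if u = x ∧ v = y then δ.a x y + (1 + δ.a x p) else
      if u = y ∧ v = x then δ.a y x + (1 + δ.a y p) else δ.a u v
    f := Function.update δ.f s(x, y) (δ.f s(x, y) + (1 + min (δ.f s(x, p)) (δ.f s(y, p))))
    lo := Function.update δ.lo s(x, y) (δ.lo s(x, y) +
      (1 + max (δ.lo s(x, p) + δ.W s(y, p) - (K - 3)) (δ.W s(x, p) + δ.lo s(y, p) - (K - 3))))
    W := Function.update δ.W s(x, y) (max
      (δ.W s(x, y) + (1 + max (δ.lo s(x, p) + δ.W s(y, p) - (K - 3))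
        (δ.W s(x, p) + δ.lo s(y, p) - (K - 3))))
      (δ.lo s(x, y) + (1 + max (δ.lo s(x, p) + δ.lo s(y, p))
        (δ.W s(x, p) + δ.W s(y, p) - (K - 3))))) }

end PaletteExtension

/-! ### Adding a vertex on an edge, and the colouring -/

section EdgeExtension

open Finset

variable {V : Type*}

theorem IsDecoration.contract_valid [Finite V] {G : SimpleGraph V} {K : ℕ} (hG : LinkBounded G K)
    {S : Set V} {x y p : V} (hx : x ∈ S) (hy : y ∈ S) (hxy : G.Adj x y)
    (hxp : G.Adj x p) (hyp : G.Adj y p) {δ : Decoration V}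
    (hδ : IsDecoration G K (insert p S) δ) :
    EdgeValid G K x y ((δ.contract K x y p).D s(x, y)) ((δ.contract K x y p).a x y)
      ((δ.contract K x y p).a y x) ((δ.contract K x y p).f s(x, y))
      ((δ.contract K x y p).lo s(x, y)) ((δ.contract K x y p).W s(x, y)) ∧
    SideBounds (K - 2) (1 + δ.a x p) (1 + δ.a y p) (1 + min (δ.f s(x, p)) (δ.f s(y, p)))
      (1 + max (δ.lo s(x, p) + δ.W s(y, p) - (K - 3)) (δ.W s(x, p) + δ.lo s(y, p) - (K - 3)))
      (1 + max (δ.lo s(x, p) + δ.lo s(y, p)) (δ.W s(x, p) + δ.W s(y, p) - (K - 3))) 0 ∧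
    δ.a p x + δ.a p y + 3 ≤ K := by
  have hp' : p ∈ insert p S := .inl rfl
  have hx' : x ∈ insert p S := .inr hx
  have hy' : y ∈ insert p S := .inr hy
  have n1 := hxy.ne
  have n2 := hxp.ne
  have n3 := hyp.ne
  have key := EdgeValid.contract hG hxy hxp hyp (hδ.valid hx' hy' hxy) (hδ.valid hx' hp' hxp)
    (hδ.valid hy' hp' hyp) (hδ.disj hx' hy' hxy hx' hp' hxp (by simp; tauto))
    (hδ.disj hx' hy' hxy hy' hp' hyp (by simp; tauto))
    (hδ.disj hx' hp' hxp hy' hp' hyp (by simp; tauto))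
    (by simp only [Set.mem_union, not_or]
        exact ⟨⟨hδ.out hx' hy' hxy hx', hδ.out hx' hp' hxp hx'⟩, hδ.out hy' hp' hyp hx'⟩)
    (by simp only [Set.mem_union, not_or]
        exact ⟨⟨hδ.out hx' hy' hxy hy', hδ.out hx' hp' hxp hy'⟩, hδ.out hy' hp' hyp hy'⟩)
    (by simp only [Set.mem_union, not_or]
        exact ⟨⟨hδ.out hx' hy' hxy hp', hδ.out hx' hp' hxp hp'⟩, hδ.out hy' hp' hyp hp'⟩)
  simpa [Decoration.contract, n1, n1.symm] using key

theorem IsDecoration.contract [Finite V] {G : SimpleGraph V} {K : ℕ} (hG : LinkBounded G K)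
    {S : Set V} {x y p : V} (hp : p ∉ S) (hx : x ∈ S) (hy : y ∈ S) (hxy : G.Adj x y)
    (hxp : G.Adj x p) (hyp : G.Adj y p) {δ : Decoration V}
    (hδ : IsDecoration G K (insert p S) δ) : IsDecoration G K S (δ.contract K x y p) := by
  classical
  have hp' : p ∈ insert p S := .inl rfl
  have hx' : x ∈ insert p S := .inr hx
  have hy' : y ∈ insert p S := .inr hy
  have hS : S ⊆ insert p S := Set.subset_insert _ _
  have hδ' := hδ.mono hS
  have ne : ∀ {z}, z ∈ S → z ≠ p := fun hz e => hp (e ▸ hz)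
  have hval := (hδ.contract_valid hG hx hy hxy hxp hyp).1
  have hD : (δ.contract K x y p).D s(x, y) =
      δ.D s(x, y) ∪ ({p} ∪ (δ.D s(x, p) ∪ δ.D s(y, p))) := by simp [Decoration.contract]
  have hD' : ∀ {e}, e ≠ s(x, y) → (δ.contract K x y p).D e = δ.D e := by
    intro e he; simp [Decoration.contract, he]
  have disj : ∀ {w z}, w ∈ S → z ∈ S → G.Adj w z → s(w, z) ≠ s(x, y) →
      Disjoint ((δ.contract K x y p).D s(x, y)) (δ.D s(w, z)) := by
    intro w z hw hz hwz hne
    rw [hD]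
    simp only [Set.disjoint_union_left, Set.disjoint_singleton_left]
    have nw := ne hw
    have nz := ne hz
    refine ⟨hδ'.disj hx hy hxy hw hz hwz hne.symm, hδ.out (hS hw) (hS hz) hwz hp',
      hδ.disj hx' hp' hxp (hS hw) (hS hz) hwz ?_, hδ.disj hy' hp' hyp (hS hw) (hS hz) hwz ?_⟩ <;>
    · simp only [ne_eq, Sym2.eq_iff]
      grind
  refine ⟨?_, ?_, ?_⟩
  · intro u v hu hv huv
    by_cases e : s(u, v) = s(x, y)
    · rcases Sym2.eq_iff.1 e with ⟨rfl, rfl⟩ | ⟨rfl, rfl⟩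
      · exact hval
      · rw [Sym2.eq_swap]; exact hval.symm
    · have e' : ¬(u = x ∧ v = y) := by rintro ⟨rfl, rfl⟩; exact e rfl
      have e'' : ¬(u = y ∧ v = x) := by rintro ⟨rfl, rfl⟩; exact e Sym2.eq_swap
      have e3 : ¬(v = x ∧ u = y) := fun h => e'' h.symm
      have e4 : ¬(v = y ∧ u = x) := fun h => e' h.symm
      simpa only [Decoration.contract, Function.update_of_ne e, if_neg e', if_neg e'', if_neg e3,
        if_neg e4] using hδ'.valid hu hv huv
  · intro u v w hu hv huv hw
    by_cases e : s(u, v) = s(x, y)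
    · rw [e, hD]
      simp only [Set.mem_union, Set.mem_singleton_iff, not_or]
      exact ⟨hδ'.out hx hy hxy hw, ne hw, hδ.out hx' hp' hxp (hS hw), hδ.out hy' hp' hyp (hS hw)⟩
    · rw [hD' e]
      exact hδ'.out hu hv huv hw
  · intro u v w z hu hv huv hw hz hwz hne
    by_cases e : s(u, v) = s(x, y)
    · rw [e] at hne ⊢
      rw [hD' hne.symm]
      exact disj hw hz hwz hne.symm
    · rw [hD' e]
      by_cases e' : s(w, z) = s(x, y)
      · rw [e']
        exact (disj hu hv huv e).symm
      · rw [hD' e']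
        exact hδ'.disj hu hv huv hw hz hwz hne

/-- The colour sets at `xy` are split into a part for the old side and a part for the block of `p`.
A colour common to both block parts goes to `p`; the rest serve `x` at `xp` and `y` at `yp`.
Disjoint sets `D` and `E` are then chosen around `p`. -/
theorem IsPalette.joinEdge [Finite V] {G : SimpleGraph V} {K : ℕ} (hG : LinkBounded G K)
    {S : Set V} {x y p : V} (hp : p ∉ S) (hx : x ∈ S) (hy : y ∈ S) (hxy : G.Adj x y)
    (hadj : ∀ z ∈ S, G.Adj p z ↔ z = x ∨ z = y) {δ : Decoration V}
    (hδ : IsDecoration G K (insert p S) δ) {c : V → Fin K} {A : V → V → Finset (Fin K)}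
    (h : IsPalette G S (δ.contract K x y p) c A) :
    ∃ (c' : V → Fin K) (A' : V → V → Finset (Fin K)), IsPalette G (insert p S) δ c' A' := by
  classical
  have hxp : G.Adj x p := ((hadj x hx).2 (.inl rfl)).symm
  have hyp : G.Adj y p := ((hadj y hy).2 (.inr rfl)).symm
  have hp' : p ∈ insert p S := .inl rfl
  have hx' : x ∈ insert p S := .inr hx
  have hy' : y ∈ insert p S := .inr hy
  obtain ⟨-, hs, hd⟩ := hδ.contract_valid hG hx hy hxy hxp hyp
  have v1 := hδ.valid hx' hy' hxy
  have v2 := hδ.valid hx' hp' hxp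
  have v3 := hδ.valid hy' hp' hyp
  have b1 := v1.bounds Flow.zero
  -- The single link `{y}` already gives `W + 1 ≤ K - 2`, so the required union fits into the `K -
  -- 3` colours other than those of `x`, `y`, `p`.
  have b2 := v2.bounds ((Flow.single hxy hyp.symm).mono (m := 1) (by
    simpa using ⟨hxy.ne', hyp.ne, hδ.out hx' hp' hxp hy'⟩) le_rfl)
  have b3 := v3.bounds ((Flow.single hxy.symm hxp.symm).mono (m := 1) (by
    simpa using ⟨hxy.ne, hxp.ne, hδ.out hy' hp' hyp hx'⟩) le_rfl)
  have n1 := hxy.ne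
  have n1' := hxy.ne'
  have cP := h.card hx hy hxy
  have cQ := h.card hy hx hxy.symm
  have hI := h.inter hx hy hxy
  have hU := h.union hx hy hxy
  simp only [Decoration.contract, Function.update_self, n1, n1', and_self, if_true, if_false]
    at cP cQ hI hU
  obtain ⟨P₁, Pc, Q₁, Qc, P1, P2, dP, Q1, Q2, dQ, cP₁, cPc, cQ₁, cQc, i1, u1, ic, uc⟩ :=
    exists_split cP cQ b1.lo_le.1 b1.lo_le.2 b1.lo_add hs.lo_le.1 hs.lo_le.2 hs.lo_add hI
      ((le_max_left _ _).trans hU) ((le_max_right _ _).trans hU)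
  -- The summand 1 in the block's `lo` ensures a common colour.
  obtain ⟨γ, hγ⟩ : ∃ γ, γ ∈ Pc ∩ Qc := card_pos.1 (by omega)
  have hγP : γ ∈ Pc := (mem_inter.1 hγ).1
  have hγQ : γ ∈ Qc := (mem_inter.1 hγ).2
  have xP : c x ∉ A x y := fun hm => h.own hx hy hxy (mem_insert_of_mem hm)
  have xQ : c x ∉ A y x := h.nbr hy hx hxy.symm
  have yP : c y ∉ A x y := h.nbr hx hy hxy
  have yQ : c y ∉ A y x := fun hm => h.own hy hx hxy.symm (mem_insert_of_mem hm)
  have xy : c x ≠ c y := fun e => h.own hx hy hxy (by rw [e]; exact mem_insert_self _ _)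
  have xγ : c x ≠ γ := fun e => xP (e ▸ P2 hγP)
  have yγ : c y ≠ γ := fun e => yP (e ▸ P2 hγP)
  obtain ⟨X, hX⟩ : ∃ X : Finset (Fin K), X = univ \ {c x, c y, γ} := ⟨_, rfl⟩
  have cX : #X = K - 3 := by
    rw [hX, card_sdiff_of_subset (subset_univ _), card_eq_three.2 ⟨_, _, _, xy, xγ, yγ, rfl⟩]
    simp
  have mX : ∀ {z}, z ∈ X ↔ z ≠ c x ∧ z ≠ c y ∧ z ≠ γ := by intro z; rw [hX]; simp
  have hPX : Pc.erase γ ⊆ X := fun z hz => by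
    obtain ⟨hz1, hz2⟩ := mem_erase.1 hz
    exact mX.2 ⟨fun e => xP (e ▸ P2 hz2), fun e => yP (e ▸ P2 hz2), hz1⟩
  have hQX : Qc.erase γ ⊆ X := fun z hz => by
    obtain ⟨hz1, hz2⟩ := mem_erase.1 hz
    exact mX.2 ⟨fun e => xQ (e ▸ Q2 hz2), fun e => yQ (e ▸ Q2 hz2), hz1⟩
  have cP₂ : #(Pc.erase γ) = δ.a x p := by rw [card_erase_of_mem hγP]; omega
  have cQ₃ : #(Qc.erase γ) = δ.a y p := by rw [card_erase_of_mem hγQ]; omega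
  have ci : #(Pc.erase γ ∩ Qc.erase γ) = #(Pc ∩ Qc) - 1 := by
    rw [← card_erase_of_mem hγ]; congr 1; ext z; simp only [mem_inter, mem_erase]; tauto
  have cu : #(Pc.erase γ ∪ Qc.erase γ) = #(Pc ∪ Qc) - 1 := by
    rw [← erase_union_distrib, card_erase_of_mem (mem_union_left _ hγP)]
  -- The four terms of the maxima supply the four joint conditions of `exists_disjoint_pair`.
  have m1 := le_max_left (δ.lo s(x, p) + δ.W s(y, p) - (K - 3)) (δ.W s(x, p) + δ.lo s(y, p) - (K - 3))
  have m2 := le_max_right (δ.lo s(x, p) + δ.W s(y, p) - (K - 3)) (δ.W s(x, p) + δ.lo s(y, p) - (K - 3))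
  have m3 := le_max_left (δ.lo s(x, p) + δ.lo s(y, p)) (δ.W s(x, p) + δ.W s(y, p) - (K - 3))
  have m4 := le_max_right (δ.lo s(x, p) + δ.lo s(y, p)) (δ.W s(x, p) + δ.W s(y, p) - (K - 3))
  obtain ⟨b21, b22, b23, b24, -, -, -⟩ := b2
  obtain ⟨b31, b32, b33, b34, -, -, -⟩ := b3
  obtain ⟨D, E, hD, hE, dDE, cD, cE, iD, uD, iE, uE⟩ :=
    exists_disjoint_pair hPX hQX (d := δ.a p x) (e := δ.a p y) (lo₂ := δ.lo s(x, p))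
      (lo₃ := δ.lo s(y, p)) (W₂ := δ.W s(x, p)) (W₃ := δ.W s(y, p)) (by omega) (by omega)
      (by omega) (by omega) (by omega) (by omega) (by omega) (by omega) (by omega) (by omega)
      (by omega) (by omega) (by omega)
  have iP : insert γ (Pc.erase γ) = Pc := insert_erase hγP
  have iQ : insert γ (Qc.erase γ) = Qc := insert_erase hγQ
  have nD : ∀ {z}, z ∈ D → z ≠ c x ∧ z ≠ c y ∧ z ≠ γ := fun hz => mX.1 (hD hz)
  have nE : ∀ {z}, z ∈ E → z ≠ c x ∧ z ≠ c y ∧ z ≠ γ := fun hz => mX.1 (hE hz)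
  have only : ∀ {z}, z ∈ S → G.Adj z p → z = x ∨ z = y := fun hz hzp => (hadj _ hz).1 hzp.symm
  have ne : ∀ {z}, z ∈ S → z ≠ p := fun hz e => hp (e ▸ hz)
  obtain ⟨A', hA'⟩ : ∃ A' : V → V → Finset (Fin K), A' = fun z w =>
      if z = p then (if w = x then D else E) else
      if w = p then (if z = x then Pc.erase γ else Qc.erase γ) else
      if z = x ∧ w = y then P₁ else if z = y ∧ w = x then Q₁ else A z w := ⟨_, rfl⟩
  have A1 : A' p x = D := by simp [hA']
  have A2 : A' p y = E := by simp [hA', n1']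
  have A3 : A' x p = Pc.erase γ := by simp [hA', hxp.ne]
  have A4 : A' y p = Qc.erase γ := by simp [hA', hyp.ne, n1']
  have A5 : A' x y = P₁ := by simp [hA', hxp.ne, hyp.ne]
  have A6 : A' y x = Q₁ := by simp [hA', hxp.ne, hyp.ne, n1']
  have A7 : ∀ {z w}, z ∈ S → w ∈ S → s(z, w) ≠ s(x, y) → A' z w = A z w := by
    intro z w hz hw e
    have e' : ¬(z = x ∧ w = y) := by rintro ⟨rfl, rfl⟩; exact e rfl
    have e'' : ¬(z = y ∧ w = x) := by rintro ⟨rfl, rfl⟩; exact e Sym2.eq_swap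
    simp only [hA', if_neg (ne hz), if_neg (ne hw), if_neg e', if_neg e'']
  have hsub : ∀ {z w}, z ∈ S → w ∈ S → G.Adj z w → A' z w ⊆ A z w := by
    intro z w hz hw _
    by_cases e : s(z, w) = s(x, y)
    · rcases Sym2.eq_iff.1 e with ⟨rfl, rfl⟩ | ⟨rfl, rfl⟩
      · rw [A5]; exact P1
      · rw [A6]; exact Q1
    · rw [A7 hz hw e]
  refine ⟨fun z => if z = p then γ else c z, A', h.extend ?_ hsub ?_ ?_ ?_ ?_ ?_ ?_⟩
  · intro z hz; simp [ne hz]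
  · intro z hz hzp
    simp only [if_true]
    rcases only hz hzp with rfl | rfl
    · rw [A1, A3, iP]
      exact ⟨by simpa using ⟨xγ.symm, fun hm => (nD hm).2.2 rfl⟩, fun hm => xP (P2 hm)⟩
    · rw [A2, A4, iQ]
      exact ⟨by simpa using ⟨yγ.symm, fun hm => (nE hm).2.2 rfl⟩, fun hm => yQ (Q2 hm)⟩
  · intro z hz hzp
    simp only [if_true]
    rcases only hz hzp with rfl | rfl
    · rw [A1, A3]
      exact ⟨fun hm => (nD hm).1 rfl, by simp⟩
    · rw [A2, A4]
      exact ⟨fun hm => (nE hm).2.1 rfl, by simp⟩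
  · have key : Disjoint (insert (c x) D) (insert (c y) E) := by
      rw [disjoint_left] at dDE ⊢
      simp only [mem_insert]
      rintro z (rfl | hz) (e | hz')
      · exact xy e
      · exact (nE hz').1 rfl
      · exact (nD hz).2.1 e
      · exact dDE hz hz'
    intro v w hv hw hpv hpw hvw
    rcases only hv hpv.symm with rfl | rfl <;> rcases only hw hpw.symm with rfl | rfl
    · exact (hvw rfl).elim
    · rw [A1, A2]; exact key
    · rw [A1, A2]; exact key.symm
    · exact (hvw rfl).elim
  · intro z w hz hw hzw hzp
    simp only [if_true]
    rcases only hz hzp with rfl | rfl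
    · rw [A3, iP]
      by_cases e : w = y
      · subst e
        rw [A5, disjoint_insert_left]
        exact ⟨fun hm => yP (P2 hm), dP⟩
      · rw [A7 hz hw (by simp [hzw.ne', e])]
        exact (h.disj hz hw hy hzw hxy e).mono le_rfl (P2.trans (subset_insert _ _))
    · rw [A4, iQ]
      by_cases e : w = x
      · subst e
        rw [A6, disjoint_insert_left]
        exact ⟨fun hm => xQ (Q2 hm), dQ⟩
      · rw [A7 hz hw (by simp [hzw.ne', e])]
        exact (h.disj hz hw hx hzw hxy.symm e).mono le_rfl (Q2.trans (subset_insert _ _))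
  · intro u v hu hv huv
    by_cases e : s(u, v) = s(x, y)
    · rcases Sym2.eq_iff.1 e with ⟨rfl, rfl⟩ | ⟨rfl, rfl⟩
      · rw [A5, A6]; exact ⟨cP₁, i1, u1⟩
      · rw [A5, A6, Sym2.eq_swap, inter_comm, union_comm]; exact ⟨cQ₁, i1, u1⟩
    · have e' : ¬(u = x ∧ v = y) := by rintro ⟨rfl, rfl⟩; exact e rfl
      have e'' : ¬(u = y ∧ v = x) := by rintro ⟨rfl, rfl⟩; exact e Sym2.eq_swap
      rw [A7 hu hv e, A7 hv hu (by rwa [Sym2.eq_swap])]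
      have k1 := h.card hu hv huv
      have k2 := h.inter hu hv huv
      have k3 := h.union hu hv huv
      simp only [Decoration.contract, Function.update_of_ne e, if_neg e', if_neg e''] at k1 k2 k3
      exact ⟨k1, k2, k3⟩
  · intro z hz hzp
    rcases only hz hzp with rfl | rfl
    · rw [A1, A3]; exact ⟨cP₂, cD, iD, uD⟩
    · rw [A2, A4]; exact ⟨cQ₃, cE, iE, uE⟩

/-- The decoration is quantified inside the induction because removing a vertex on an edge changes
it. -/
theorem BuiltOn.exists_palette [Finite V] {G : SimpleGraph V} {K : ℕ} (hG : LinkBounded G K)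
    {S : Set V} (hS : BuiltOn G S) : ∀ {δ : Decoration V}, IsDecoration G K S δ →
    ∃ (c : V → Fin K) (A : V → V → Finset (Fin K)), IsPalette G S δ c A := by
  induction hS with
  | base u v huv => exact fun hδ => exists_palette_pair hG huv hδ
  | joinVertex S u w _ hw hu hadj ih =>
    intro δ hδ
    obtain ⟨c, A, h⟩ := ih (hδ.mono (Set.subset_insert _ _))
    exact h.joinVertex hG hw hu hadj hδ
  | joinEdge S u v w _ hw hu hv huv hadj ih =>
    intro δ hδ
    obtain ⟨c, A, h⟩ := ih (hδ.contract hG hw hu hv huv ((hadj u hu).2 (.inl rfl)).symm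
      ((hadj v hv).2 (.inr rfl)).symm)
    exact h.joinEdge hG hw hu hv huv hadj hδ

theorem LinkBounded.colorable [Finite V] {G : SimpleGraph V} {K : ℕ} (hG : LinkBounded G K)
    (h : IsGeneralizedTwoTree G) : (square G).Colorable K := by
  have hδ : IsDecoration G K Set.univ ⟨fun _ => ∅, fun _ _ => 0, fun _ => 0, fun _ => 0,
      fun _ => 0⟩ := by
    refine ⟨fun {u v} _ _ huv => ⟨by simp, by simp, Flow.zero, fun {φ} hφ => ?_⟩, by simp, by simp⟩
    dsimp only at hφ ⊢
    -- With zero data only `φ ≤ K - 2` needs proof: the links use distinct neighbours of `u` other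
    -- than `v`.
    have e := ncard_inter_union (N := G.neighborSet u) (X := (insert u (insert v ∅))ᶜ) (Y := {v})
      (by simp)
    have s := ncard_singleton_inter (N := G.neighborSet u) huv
    have le := Set.ncard_le_ncard (Set.inter_subset_right
      (s := (insert u (insert v ∅))ᶜ ∪ {v}) (t := G.neighborSet u))
    have := hG.degree u
    have := hφ.le_ncard
    constructor <;> omega
  obtain ⟨c, A, hc⟩ := BuiltOn.exists_palette hG h hδ
  refine ⟨SimpleGraph.Coloring.mk c fun {u v} huv => ?_⟩
  rcases square_adj_iff.1 huv with huv | ⟨hne, w, hu, hv⟩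
  · intro e
    exact hc.own trivial trivial huv (by rw [e]; exact mem_insert_self _ _)
  · intro e
    exact disjoint_left.1 (hc.disj trivial trivial trivial hu hv hne)
      (mem_insert_self _ _) (by rw [e]; exact mem_insert_self _ _)

end EdgeExtension

/-! ### Path minors from stars and triangles -/

section Minors

variable {V : Type*}

/-- `H` has a clique minor of order `t` all of whose branch sets are paths. -/
def HasPathMinor (H : SimpleGraph V) (t : ℕ) : Prop :=
  ∃ B : Fin t → H.Subgraph, IsCliqueMinor H B ∧ ∀ i, IsPathSubgraph H (B i)

theorem HasPathMinor.mono {H : SimpleGraph V} {s t : ℕ} (h : HasPathMinor H t) (hst : s ≤ t) :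
    HasPathMinor H s := by
  obtain ⟨B, hB, hp⟩ := h
  have hne : ∀ {i j : Fin s}, i ≠ j → Fin.castLE hst i ≠ Fin.castLE hst j :=
    fun hij e => hij (Fin.castLE_injective hst e)
  exact ⟨fun i => B (Fin.castLE hst i), ⟨fun i => hB.connected _,
    fun i j hij => hB.disjoint _ _ (hne hij), fun i j hij => hB.joined _ _ (hne hij)⟩,
    fun i => hp _⟩

theorem hasPathMinor_of_paths {H : SimpleGraph V} {ι : Type*} [Fintype ι] {a b : ι → V}
    (p : ∀ i, H.Walk (a i) (b i)) (hp : ∀ i, (p i).IsPath)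
    (disj : ∀ i j, i ≠ j → ∀ x ∈ (p i).support, x ∉ (p j).support)
    (joined : ∀ i j, i ≠ j → ∃ x ∈ (p i).support, ∃ y ∈ (p j).support, H.Adj x y) :
    HasPathMinor H (Fintype.card ι) := by
  let e := (Fintype.equivFin ι).symm
  refine ⟨fun i => (p (e i)).toSubgraph, ⟨fun i => (p (e i)).toSubgraph_connected,
    fun i j hij => ?_, fun i j hij => ?_⟩, fun i => ⟨_, _, p (e i), hp _, rfl⟩⟩
  · rw [Set.disjoint_left]
    simpa only [SimpleGraph.Walk.mem_verts_toSubgraph] using disj _ _ (e.injective.ne hij)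
  · simpa only [SimpleGraph.Walk.mem_verts_toSubgraph] using joined _ _ (e.injective.ne hij)

theorem hasPathMinor_of_degree [Finite V] (G : SimpleGraph V) (v : V) :
    HasPathMinor (square G) ((G.neighborSet v).ncard + 1) := by
  have := Fintype.ofFinite V
  classical
  have h := hasPathMinor_of_paths (H := square G)
    (ι := {x // x ∈ insert v (G.neighborSet v)}) (a := fun i => i) (b := fun i => i)
    (fun i => .nil) (fun i => .nil) (fun i j hij x hx hx' => by
      simp only [SimpleGraph.Walk.support_nil, List.mem_singleton] at hx hx'
      exact hij (Subtype.ext (hx.symm.trans hx'))) (by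
      rintro ⟨i, hi⟩ ⟨j, hj⟩ hij
      have hne : i ≠ j := fun e => hij (Subtype.ext e)
      refine ⟨i, by simp, j, by simp, ?_⟩
      rcases hi with rfl | hi <;> rcases hj with rfl | hj
      · exact (hne rfl).elim
      · exact square_adj_of_adj hj
      · exact (square_adj_of_adj hi).symm
      · exact square_adj_of_common hi hj hne)
  have hc : Fintype.card {x // x ∈ insert v (G.neighborSet v)} = (G.neighborSet v).ncard + 1 := by
    rw [← Set.ncard_insert_of_notMem (show v ∉ G.neighborSet v by simp),
      ← Nat.card_eq_fintype_card]
    rfl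
  rwa [hc] at h

/-- Only the two end vertices of a link matter for adjacency, so a path between them inside the link
can replace it. -/
theorem IsLink.exists_path {G : SimpleGraph V} {u v : V} {B : Set V} (h : IsLink G u v B) :
    ∃ (x y : V) (p : (square G).Walk x y), p.IsPath ∧ (∀ z ∈ p.support, z ∈ B) ∧
      G.Adj u x ∧ G.Adj v y := by
  obtain ⟨x, hx, hux⟩ := h.left
  obtain ⟨y, hy, hvy⟩ := h.right
  obtain ⟨p, hp⟩ := (h.connected.preconnected ⟨x, hx⟩ ⟨y, hy⟩).exists_isPath
  refine ⟨_, _, p.map (SimpleGraph.Embedding.induce (G := square G) B).toHom,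
    hp.map (SimpleGraph.Embedding.induce (G := square G) B).injective, ?_, hux, hvy⟩
  intro z hz
  rw [SimpleGraph.Walk.support_map, List.mem_map] at hz
  obtain ⟨w, -, rfl⟩ := hz
  exact w.2

/-- Any two sides of a triangle share a corner (`pigeon`), so two links have distinct ends adjacent
in `G` to the same corner. -/
theorem hasPathMinor_of_links {G : SimpleGraph V} {q : Fin 3 → V}
    (hq : ∀ r r', r ≠ r' → G.Adj (q r) (q r')) {κ : Type*} [Fintype κ] {s t : κ → Fin 3}
    (hst : ∀ k, s k ≠ t k) {B : κ → Set V} (hB : ∀ k, IsLink G (q (s k)) (q (t k)) (B k))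
    (disj : ∀ k l, k ≠ l → Disjoint (B k) (B l)) (hqB : ∀ r k, q r ∉ B k) :
    HasPathMinor (square G) (3 + Fintype.card κ) := by
  choose x y p hp hpB hx hy using fun k => (hB k).exists_path
  have pigeon : ∀ a b c d : Fin 3, a ≠ b → c ≠ d → (a = c ∨ a = d) ∨ (b = c ∨ b = d) := by decide
  -- The corner `q r` is either `q (s k)` or a neighbour of it, hence within distance two of the
  -- start of path `k`.
  have corner : ∀ r k, (square G).Adj (q r) (x k) := by
    intro r k
    by_cases e : s k = r
    · exact square_adj_of_adj (e ▸ hx k)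
    · exact square_adj_of_common (hq _ _ e) (hx k)
        fun e' => hqB r k (e' ▸ hpB k _ (p k).start_mem_support)
  have h := hasPathMinor_of_paths (H := square G) (ι := Fin 3 ⊕ κ) (a := Sum.elim q x)
    (b := Sum.elim q y) (fun i => match i with
      | .inl r => .nil
      | .inr k => p k) (by
      rintro (r | k)
      · exact .nil
      · exact hp k) (by
      rintro (r | k) (r' | k') hij z hz hz'
      · simp only [Sum.elim_inl, SimpleGraph.Walk.support_nil, List.mem_singleton] at hz hz'
        exact (hq r r' fun e => hij (e ▸ rfl)).ne (hz.symm.trans hz')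
      · simp only [Sum.elim_inl, SimpleGraph.Walk.support_nil, List.mem_singleton] at hz
        exact hqB r k' (hz ▸ hpB k' z hz')
      · simp only [Sum.elim_inl, SimpleGraph.Walk.support_nil, List.mem_singleton] at hz'
        exact hqB r' k (hz' ▸ hpB k z hz)
      · exact Set.disjoint_left.1 (disj k k' fun e => hij (e ▸ rfl)) (hpB k z hz)
          (hpB k' z hz')) (by
      rintro (r | k) (r' | k') hij
      · exact ⟨q r, by simp, q r', by simp, square_adj_of_adj (hq r r' fun e => hij (e ▸ rfl))⟩
      · exact ⟨q r, by simp, x k', (p k').start_mem_support, corner r k'⟩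
      · exact ⟨x k, (p k).start_mem_support, q r', by simp, (corner r' k).symm⟩
      · have hd := Set.disjoint_left.1 (disj k k' fun e => hij (e ▸ rfl))
        have common : ∀ {w z z'}, z ∈ (p k).support → z' ∈ (p k').support → G.Adj w z →
            G.Adj w z' → ∃ z ∈ (p k).support, ∃ z' ∈ (p k').support, (square G).Adj z z' :=
          fun {w z z'} hz hz' h h' => ⟨z, hz, z', hz', square_adj_of_common h h'
            fun e => hd (hpB k z hz) (e ▸ hpB k' z' hz')⟩
        have hxk := hx k
        have hyk := hy k
        rcases pigeon _ _ _ _ (hst k) (hst k') with (e | e) | (e | e) <;>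
          first | rw [e] at hxk | rw [e] at hyk
        · exact common (p k).start_mem_support (p k').start_mem_support hxk (hx k')
        · exact common (p k).start_mem_support (p k').end_mem_support hxk (hy k')
        · exact common (p k).end_mem_support (p k').start_mem_support hyk (hx k')
        · exact common (p k).end_mem_support (p k').end_mem_support hyk (hy k'))
  rwa [Fintype.card_sum, Fintype.card_fin] at h

theorem linkBounded_of_not_hasPathMinor [Finite V] {G : SimpleGraph V} {K : ℕ}
    (h : ¬ HasPathMinor (square G) (K + 1)) : LinkBounded G K := by
  refine ⟨fun v => ?_, ?_⟩
  · by_contra hv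
    exact h ((hasPathMinor_of_degree G v).mono (by omega))
  · intro u v d X₁ X₂ X₃ m₁ m₂ m₃ huv hud hvd d12 d13 d23 hu hv hd h1 h2 h3
    by_contra hK
    refine h (HasPathMinor.mono (t := 3 + (m₁ + (m₂ + m₃))) ?_ (by omega))
    obtain ⟨B₁, s1, e1, l1⟩ := h1
    obtain ⟨B₂, s2, e2, l2⟩ := h2
    obtain ⟨B₃, s3, e3, l3⟩ := h3
    have key := hasPathMinor_of_links (G := G) (q := ![u, v, d])
      (κ := Fin m₁ ⊕ (Fin m₂ ⊕ Fin m₃))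
      (s := Sum.elim (fun _ => 0) (Sum.elim (fun _ => 0) fun _ => 1))
      (t := Sum.elim (fun _ => 1) (Sum.elim (fun _ => 2) fun _ => 2))
      (B := Sum.elim B₁ (Sum.elim B₂ B₃)) ?_ ?_ ?_ ?_ ?_
    · simpa using key
    · intro r r' hr
      fin_cases r <;> fin_cases r' <;> simp_all [SimpleGraph.adj_comm]
    · rintro (k | k | k) <;> simp
    · rintro (k | k | k)
      · exact l1 k
      · exact l2 k
      · exact l3 k
    · rintro (k | k | k) (l | l | l) hkl
      · exact e1 k l fun e => hkl (e ▸ rfl)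
      · exact d12.mono (s1 k) (s2 l)
      · exact d13.mono (s1 k) (s3 l)
      · exact (d12.mono (s1 l) (s2 k)).symm
      · exact e2 k l fun e => hkl (e ▸ rfl)
      · exact d23.mono (s2 k) (s3 l)
      · exact (d13.mono (s1 l) (s3 k)).symm
      · exact (d23.mono (s2 l) (s3 k)).symm
      · exact e3 k l fun e => hkl (e ▸ rfl)
    · have sub : ∀ k, Sum.elim B₁ (Sum.elim B₂ B₃) k ⊆ X₁ ∪ X₂ ∪ X₃ := by
        rintro (k | k | k)
        · exact (s1 k).trans fun z hz => .inl (.inl hz)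
        · exact (s2 k).trans fun z hz => .inl (.inr hz)
        · exact (s3 k).trans fun z hz => .inr hz
      intro r k hr
      have := sub k hr
      fin_cases r
      · exact hu this
      · exact hv this
      · exact hd this

theorem IsGeneralizedTwoTree.colorable_or_hasPathMinor [Finite V] {G : SimpleGraph V}
    (hG : IsGeneralizedTwoTree G) (K : ℕ) :
    (square G).Colorable K ∨ HasPathMinor (square G) (K + 1) := by
  by_cases h : HasPathMinor (square G) (K + 1)
  · exact .inr h
  · exact .inl ((linkBounded_of_not_hasPathMinor h).colorable hG)

end Minors

end HadwigerSquares

/-! ### Conclusion -/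

theorem corollary2 {V : Type*} [Finite V] (G : SimpleGraph V)
    (hG : HadwigerSquares.IsGeneralizedTwoTree G) :
    HadwigerSquares.HadwigerHolds (HadwigerSquares.square G) ∧
    ∃ t : ℕ, (HadwigerSquares.square G).chromaticNumber = (t : ℕ∞) ∧
      ∃ B : Fin t → (HadwigerSquares.square G).Subgraph,
        HadwigerSquares.IsCliqueMinor (HadwigerSquares.square G) B ∧
        ∀ i, HadwigerSquares.IsPathSubgraph (HadwigerSquares.square G) (B i) := by
  constructor
  · intro t _ hK
    rcases hG.colorable_or_hasPathMinor t with h | ⟨B, hB, -⟩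
    · exact h
    · exact (hK ⟨B, hB⟩).elim
  · have hc := SimpleGraph.colorable_chromaticNumber_of_fintype (HadwigerSquares.square G)
    have hle := hc.chromaticNumber_le
    refine ⟨_, (ENat.natCast_toNat (ne_top_of_le_ne_top (ENat.natCast_ne_top _) hle)).symm, ?_⟩
    rcases Nat.eq_zero_or_pos (HadwigerSquares.square G).chromaticNumber.toNat with h0 | hpos
    · rw [h0]
      exact ⟨fun i => i.elim0, ⟨fun i => i.elim0, fun i => i.elim0, fun i => i.elim0⟩,
        fun i => i.elim0⟩
    -- With `k` one below the chromatic number, `k`-colourability is impossible, which leaves a path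
    -- minor of order `k + 1`.
    · obtain ⟨k, hk⟩ := Nat.exists_eq_add_of_lt hpos
      rw [Nat.zero_add] at hk
      rw [hk]
      refine (hG.colorable_or_hasPathMinor k).resolve_left fun h => ?_
      have := ENat.toNat_le_toNat h.chromaticNumber_le (ENat.natCast_ne_top _)
      rw [hk, ENat.toNat_natCast] at this
      omega
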